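/- **Conventions.** A *continuum* is a nonempty compact connected metrizable space. An *arc* is a space homeomorphic to $[0,1]$. A *topological graph* is a continuum that is the union of finitely many arcs, any two of which intersect only at points that are endpoints of both. A *quasi-arc* in a space $X$ is the image $L=\varphi([0,\infty))$ of a continuous injection $\varphi:[0,\infty)\to X$; its endpoint is $\varphi(0)$ and its limit set is $\omega(L)=\bigcap_{m\ge 0}\overline{\varphi([m,\infty))}$. It is *oscillatory* if $\omega(L)$ has more than one point. The *valence* of a point $x\in X$ is the supremum of all $k\ge 1$ such that $X$ contains a $k$-star centered at $x$ (a union of $k$ arcs having $x$ as an endpoint and pairwise disjoint apart from $x$). $\mathrm{End}(X)$ and $\mathrm{Br}(X)$ are the sets of points of valence $1$ and of valence greater than $2$, respectively. A *quasi-graph* is a continuum $X=G\cup\bigcup_{j=1}^n L_j$, where $G\subset X$ is a topological graph, $n\ge 0$, and $L_1,\dots,L_n$ are pairwise disjoint oscillatory quasi-arcs in $X$ such that 1. $\mathrm{End}(X)\cup\mathrm{Br}(X)\subset G$; 2. $L_i\cap G=\{a_i\}$, where $a_i$ is the endpoint of $L_i$, for every $i$; 3. $\omega(L_i)\subset G\cup\bigcup_{j<i}L_j$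 for every $i$; 4. if $\omega(L_i)\cap L_j\ne\emptyset$, then $L_j\subset\omega(L_i)$, for all $i,j$. Put $\omega(X)=\bigcup_{i=1}^n\omega(L_i)$. A continuum $\Lambda$ is in *Class(W)* if for every continuum $S$ and every continuous surjection $f:S\to\Lambda$, every subcontinuum of $\Lambda$ is the image under $f$ of a subcontinuum of $S$. Let $X$ be a continuum with metric $d$, and let $d_H$ be the Hausdorff metric of $d$. $X$ is a *generalized $\sin(1/x)$-type continuum* if there are a topological graph $Y$ and a continuous surjection $\phi:X\to Y$, called an *associated map*, with connected fibers, such that * (i) every fiber $\phi^{-1}(y)$ is nowhere dense in $X$; * (ii) the union of all one-point fibers of $\phi$ is dense in $X$; * (iii) for every $y\in Y$, every subcontinuum $Y_0\subset\phi^{-1}(y)$ and every $\varepsilon>0$ there is an arc $A\subset Y$ with $d_H(Y_0,\phi^{-1}(A))<\varepsilon$. **Theorem.** Let $X=G\cup\bigcup_{j=1}^n L_j$ be a quasi-graph. Assume that for every connected component $\Lambda$ of $\omega(X)$ 1. there is a quasi-arc $L$ in $X$ with $\omega(L)=\Lambda$, and 2. the continuum $\Lambda$ belongs to Class(W). Then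 $X$ is a generalized $\sin(1/x)$-type continuum. Moreover, the quotient map $X\to X/{\sim}$ that collapses each connected component of $\omega(X)$ to a point (and identifies no other points) is an associated map; in particular $X/{\sim}$ is a topological graph. -/

import Mathlib

open Set Topology
open scoped NNReal

universe u

namespace Tranched

/-- A continuum: a (nonempty) compact connected metrizable space. -/
structure IsContinuum (X : Type*) [TopologicalSpace X] : Prop where
  compact : CompactSpace X
  connected : ConnectedSpace X
  metrizable : TopologicalSpace.MetrizableSpace X

/-- A subset of a metrizable space that is a continuum in the subspace topology. -/
def IsSubcontinuum {X : Type*} [TopologicalSpace X] (K : Set X) : Prop :=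
  IsCompact K ∧ IsConnected K

/-- An arc in `X`: a subset that is homeomorphic to `[0,1]`. -/
def IsArc {X : Type*} [TopologicalSpace X] (A : Set X) : Prop :=
  ∃ e : unitInterval → X, IsEmbedding e ∧ range e = A

/-- A topological graph: a continuum that is the union of finitely many arcs (the ranges of the
`e i`), any two of which intersect only at points that are endpoints of both. -/
structure IsTopologicalGraph (Y : Type*) [TopologicalSpace Y] : Prop where
  continuum : IsContinuum Y
  edges : ∃ (m : ℕ) (e : Fin m → unitInterval → Y),
    (∀ i, IsEmbedding (e i)) ∧
    (⋃ i, range (e i)) = univ ∧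
    ∀ i j, i ≠ j → ∀ s t, e i s = e j t → (s = 0 ∨ s = 1) ∧ (t = 0 ∨ t = 1)

/-- The standard `k`-star: the segments from the origin to the `k` standard unit vectors of
`ℝ^k`. Its center is the origin. -/
def starModel (k : ℕ) : Set (Fin k → ℝ) :=
  {v | v = 0 ∨ ∃ i, ∃ t ∈ Icc (0 : ℝ) 1, v = Pi.single i t}

/-- The center of the standard `k`-star. -/
def starCenter (k : ℕ) : starModel k := ⟨0, Or.inl rfl⟩

/-- `X` contains a `k`-star centered at `x`. -/
def HasStarAt {X : Type*} [TopologicalSpace X] (k : ℕ) (x : X) : Prop :=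
  ∃ h : starModel k → X, IsEmbedding h ∧ h (starCenter k) = x

/-- The valence of `x` in `X`: the supremum of all `k ≥ 1` such that `X` contains a `k`-star
centered at `x`. -/
noncomputable def valence {X : Type*} [TopologicalSpace X] (x : X) : ℕ∞ :=
  sSup {v : ℕ∞ | ∃ k : ℕ, 1 ≤ k ∧ HasStarAt k x ∧ v = k}

/-- `End(X)`, the set of endpoints. -/
def endPoints (X : Type*) [TopologicalSpace X] : Set X := {x | valence x = 1}

/-- `Br(X)`, the set of branching points. -/
def branchPoints (X : Type*) [TopologicalSpace X] : Set X := {x | 2 < valence x}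

/-- `φ : [0,∞) → X` parametrizes a quasi-arc, namely its range. -/
structure IsQuasiArc {X : Type*} [TopologicalSpace X] (φ : ℝ≥0 → X) : Prop where
  continuous : Continuous φ
  injective : Function.Injective φ

/-- The limit set `ω(L)` of the quasi-arc `L` parametrized by `φ`. -/
def limitSet {X : Type*} [TopologicalSpace X] (φ : ℝ≥0 → X) : Set X :=
  ⋂ m : ℝ≥0, closure (φ '' Ici m)

/-- The quasi-arc parametrized by `φ` is oscillatory. -/
def IsOscillatory {X : Type*} [TopologicalSpace X] (φ : ℝ≥0 → X) : Prop :=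
  (limitSet φ).Nontrivial

/-- `X` is a quasi-graph with the decomposition `X = G ∪ L 0 ∪ ⋯ ∪ L (n - 1)`, where the quasi-arc
`L i` is given by a parametrization `ℝ≥0 → X` and has the endpoint `L i 0`. -/
structure IsQuasiGraph {X : Type*} [TopologicalSpace X] (G : Set X) {n : ℕ}
    (L : Fin n → ℝ≥0 → X) : Prop where
  continuum : IsContinuum X
  graph : IsTopologicalGraph G
  quasiArc : ∀ i, IsQuasiArc (L i)
  oscillatory : ∀ i, IsOscillatory (L i)
  disjoint : ∀ i j, i ≠ j → Disjoint (range (L i)) (range (L j))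
  union_eq : (G ∪ ⋃ i, range (L i)) = univ
  end_branch_subset : endPoints X ∪ branchPoints X ⊆ G
  inter_graph : ∀ i, range (L i) ∩ G = {L i 0}
  limitSet_subset : ∀ i, limitSet (L i) ⊆ G ∪ ⋃ j, ⋃ (_ : j < i), range (L j)
  subset_limitSet : ∀ i j, (limitSet (L i) ∩ range (L j)).Nonempty → range (L j) ⊆ limitSet (L i)

/-- `ω(X)`, the union of the limit sets of the quasi-arcs `L i`. -/
def omegaSet {X : Type*} [TopologicalSpace X] {n : ℕ} (L : Fin n → ℝ≥0 → X) : Set X :=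
  ⋃ i, limitSet (L i)

/-- The set of connected components of a subset `W` of `X`. -/
def componentsOf {X : Type*} [TopologicalSpace X] (W : Set X) : Set (Set X) :=
  {Λ | ∃ x ∈ W, Λ = connectedComponentIn W x}

/-- The equivalence relation that collapses every connected component of `W` to a point. -/
def collapse {X : Type*} [TopologicalSpace X] (W : Set X) : Setoid X where
  r a b := a = b ∨ ∃ Λ ∈ componentsOf W, a ∈ Λ ∧ b ∈ Λ
  iseqv := by
    refine ⟨fun a => Or.inl rfl, ?_, ?_⟩
    · rintro a b (h | ⟨Λ, hΛ, ha, hb⟩)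
      · exact Or.inl h.symm
      · exact Or.inr ⟨Λ, hΛ, hb, ha⟩
    · rintro a b c (rfl | ⟨Λ, hΛ, ha, hb⟩) h
      · exact h
      · rcases h with rfl | ⟨Λ', hΛ', hb', hc⟩
        · exact Or.inr ⟨Λ, hΛ, ha, hb⟩
        · obtain ⟨x, -, rfl⟩ := hΛ
          obtain ⟨y, hy, rfl⟩ := hΛ'
          have h1 := connectedComponentIn_eq hb
          have h2 := connectedComponentIn_eq hb'
          refine Or.inr ⟨_, ⟨y, hy, rfl⟩, ?_, hc⟩
          rw [h2, ← h1]
          exact ha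

/-- Lelek's `Class(W)`: continua `X` such that for every continuous surjection `f` of a continuum
`S` onto `X`, every subcontinuum of `X` is the image of a subcontinuum of `S`. (Every continuum is
homeomorphic to a subspace of the Hilbert cube, so the universe of `S` is immaterial.) -/
structure ClassW (X : Type u) [TopologicalSpace X] : Prop where
  continuum : IsContinuum X
  weaklyConfluent : ∀ (S : Type u) [TopologicalSpace S], IsContinuum S →
    ∀ f : S → X, Continuous f → Function.Surjective f →
      ∀ K : Set X, IsSubcontinuum K → ∃ C : Set S, IsSubcontinuum C ∧ f '' C = K

/-- `φ : X → Y` is a continuous monotone map onto a topological graph `Y` that witnesses that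
`X` is a generalized sin(1/x)-type continuum. Connected sets are nonempty here, so that `φ` is
surjective. -/
structure IsSinTypeMap {X Y : Type*} [MetricSpace X] [TopologicalSpace Y] (φ : X → Y) : Prop where
  graph : IsTopologicalGraph Y
  continuous : Continuous φ
  monotone : ∀ y, IsConnected (φ ⁻¹' {y})
  nowhereDense : ∀ y, IsNowhereDense (φ ⁻¹' {y})
  dense_degenerate : Dense (φ ⁻¹' {y | ∃ x, φ ⁻¹' {y} = {x}})
  approximation : ∀ (y : Y) (K : Set X), IsSubcontinuum K → K ⊆ φ ⁻¹' {y} →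
    ∀ ε : ℝ, 0 < ε → ∃ A : Set Y, IsArc A ∧ Metric.hausdorffDist K (φ ⁻¹' A) < ε

/-- Generalized sin(1/x)-type continua. -/
structure IsGeneralizedSinContinuum (X : Type u) [MetricSpace X] : Prop where
  continuum : IsContinuum X
  exists_map : ∃ (Y : Type u) (_ : TopologicalSpace Y) (φ : X → Y), IsSinTypeMap φ

end Tranched

/-! Let `q` be the map that collapses the components of ω(X). Each component Λ is ω(L_i) for some
L_i disjoint from ω(X). Indeed, an oscillatory quasi-arc has a tail in a single L_i, whence Λ =
ω(L_i) (`exists_limitSet_eq`). If L_i met ω(X), it would lie in some ω(L_j), which lies in the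
component Λ = ω(L_i), so L_i would lie in its own limit set (`exists_limitSet_eq_component`). Hence
the complement of ω(X) is dense, its points are one-point fibres, all fibres are nowhere dense, and
`q` maps an arc of such an L_i to an arc whose preimage is the original arc.

Condition (iii) thus reduces to approximating a subcontinuum K of Λ by arcs of the ray L_i. If this
fails, every visit of the ray to a neighbourhood of K stays away from some point of a finite net of
K. Labelling each visit by a missed point gives the ray a second coordinate, and the limit set of
the lifted ray is a continuum mapping onto Λ. By Class(W) a subcontinuum of it maps onto K; the
label is constant there, so K stays away from one of its own points
(`exists_forall_exists_dist_lt`).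

The quotient is a graph because X, off ω(X) and a finite set, is a finite disjoint union of open
arcs (`exists_openArcs`), which `q` embeds as open sets with finite complement
(`isTopologicalGraph_of_openArcs`). The delicate point is that ω(X) cuts each edge of G into
finitely many pieces. This follows from connectedness of the sets ω(L_i), by induction on i, in the
form of `HasFiniteClopenTransversal`. -/

namespace Tranched
open Filter

/-! ### Limit sets of rays -/

section LimitSet

variable {X : Type*} [TopologicalSpace X] {φ : ℝ≥0 → X}

theorem mem_limitSet_iff {x : X} : x ∈ limitSet φ ↔ MapClusterPt x atTop φ := by
  simp only [limitSet, mem_iInter, mapClusterPt_iff_frequently, mem_closure_iff_nhds]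
  constructor
  · intro h s hs
    rw [frequently_atTop]
    intro a
    obtain ⟨_, hy, t, ht, rfl⟩ := h a s hs
    exact ⟨t, ht, hy⟩
  · intro h m s hs
    obtain ⟨t, ht, hs⟩ := frequently_atTop.1 (h s hs) m
    exact ⟨_, hs, t, ht, rfl⟩

theorem isClosed_limitSet : IsClosed (limitSet φ) :=
  isClosed_iInter fun _ => isClosed_closure

theorem limitSet_nonempty [CompactSpace X] : (limitSet φ).Nonempty := by
  obtain ⟨x, hx⟩ := exists_clusterPt_of_compactSpace (map φ atTop)
  exact ⟨x, mem_limitSet_iff.2 hx⟩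

theorem limitSet_subset_of_isClosed {C : Set X} (hC : IsClosed C) (m : ℝ≥0)
    (h : ∀ t, m ≤ t → φ t ∈ C) : limitSet φ ⊆ C := fun _ hx =>
  closure_minimal (image_subset_iff.2 h) hC (mem_iInter.1 hx m)

theorem limitSet_subset_closure_range : limitSet φ ⊆ closure (range φ) :=
  limitSet_subset_of_isClosed isClosed_closure 0 fun t _ => subset_closure (mem_range_self t)

/-- Otherwise the ray returns forever to the compact set `Uᶜ` and clusters there. -/
theorem eventually_mem_of_limitSet_subset [CompactSpace X] {U : Set X} (hU : IsOpen U)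
    (h : limitSet φ ⊆ U) : ∀ᶠ t in atTop, φ t ∈ U := by
  by_contra hcon
  have hf : ∃ᶠ t in atTop, φ t ∈ Uᶜ := not_eventually.1 hcon
  have : (map φ atTop ⊓ 𝓟 Uᶜ).NeBot := by
    rw [← frequently_mem_iff_neBot]; exact hf
  obtain ⟨x, hx⟩ := exists_clusterPt_of_compactSpace (map φ atTop ⊓ 𝓟 Uᶜ)
  have h1 : x ∈ limitSet φ := mem_limitSet_iff.2 (hx.mono inf_le_left)
  have h2 : x ∈ closure Uᶜ := mem_closure_iff_clusterPt.2 (hx.mono inf_le_right)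
  rw [hU.isClosed_compl.closure_eq] at h2
  exact h2 (h h1)

/-- A tail of the ray lies in the union of two disjoint open sets around the parts of a separation.
Being connected, it lies in one of them, so the other part contains no cluster point. -/
theorem isConnected_limitSet [CompactSpace X] [T2Space X] (hφ : Continuous φ) :
    IsConnected (limitSet φ) := by
  refine ⟨limitSet_nonempty, ?_⟩
  rw [isPreconnected_iff_subset_of_disjoint_closed]
  have key : ∀ A B : Set X, Disjoint (limitSet φ ∩ A) (limitSet φ ∩ B) → IsClosed A → IsClosed B →
      limitSet φ ⊆ A ∪ B → limitSet φ ⊆ A ∨ limitSet φ ⊆ B := by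
    intro A B hd hA hB hAB
    obtain ⟨U, V, hU, hV, hAU, hBV, hUV⟩ := normal_separation (isClosed_limitSet.inter hA)
      (isClosed_limitSet.inter hB) hd
    have hsub : limitSet φ ⊆ U ∪ V := fun x hx =>
      (hAB hx).imp (fun h => hAU ⟨hx, h⟩) (fun h => hBV ⟨hx, h⟩)
    obtain ⟨m, hm⟩ := eventually_atTop.1 (eventually_mem_of_limitSet_subset (hU.union hV) hsub)
    have hc : IsPreconnected (φ '' Ici m) := isPreconnected_Ici.image _ hφ.continuousOn
    rcases hc.subset_or_subset hU hV hUV (image_subset_iff.2 hm) with h | h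
    · left
      intro x hx
      refine (hAB hx).resolve_right fun hxB => ?_
      have := limitSet_subset_of_isClosed hV.isClosed_compl m
        (fun t ht => hUV.subset_compl_right (h (mem_image_of_mem _ ht))) hx
      exact this (hBV ⟨hx, hxB⟩)
    · right
      intro x hx
      refine (hAB hx).resolve_left fun hxA => ?_
      have := limitSet_subset_of_isClosed hU.isClosed_compl m
        (fun t ht => hUV.subset_compl_left (h (mem_image_of_mem _ ht))) hx
      exact this (hAU ⟨hx, hxA⟩)
  intro A B hA hB hAB hd
  refine key A B ?_ hA hB hAB
  rw [Set.disjoint_iff_inter_eq_empty, ← hd, ← inter_inter_distrib_left]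

theorem closure_range_eq [CompactSpace X] [T2Space X] (hφ : Continuous φ) :
    closure (range φ) = range φ ∪ limitSet φ := by
  refine subset_antisymm ?_ (union_subset subset_closure limitSet_subset_closure_range)
  intro x hx
  by_cases h : x ∈ limitSet φ
  · exact Or.inr h
  · left
    simp only [limitSet, mem_iInter, not_forall] at h
    obtain ⟨m, hm⟩ := h
    have : range φ = φ '' Icc 0 m ∪ φ '' Ici m := by
      rw [← image_union, ← image_univ]
      congr 1
      ext t
      simp
    rw [this, closure_union] at hx
    have h2 := hx.resolve_right hm
    rw [(isCompact_Icc.image hφ).isClosed.closure_eq] at h2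
    exact image_subset_range _ _ h2

theorem limitSet_comp_subset {σ : ℝ≥0 → ℝ≥0} (hσ : Tendsto σ atTop atTop) :
    limitSet (φ ∘ σ) ⊆ limitSet φ := fun _ hx =>
  mem_limitSet_iff.2 ((mem_limitSet_iff.1 hx).of_comp hσ)

theorem limitSet_eq_singleton [T2Space X] {x : X} (h : Tendsto φ atTop (𝓝 x)) :
    limitSet φ = {x} := by
  ext y
  rw [mem_limitSet_iff, mem_singleton_iff]
  constructor
  · intro hy
    by_contra hne
    have := hy.clusterPt.mono h
    have h2 : ClusterPt y (𝓝 x) := this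
    exact hne (eq_of_nhds_neBot h2)
  · rintro rfl
    exact h.mapClusterPt

end LimitSet

/-! ### Class(W) and approximation by arcs of a ray -/

/-- The first coordinates of the limit set of a ray in a product. -/
theorem fst_image_limitSet {X Z : Type*} [TopologicalSpace X] [T2Space X] [TopologicalSpace Z]
    [CompactSpace X] [CompactSpace Z]
    (φ : ℝ≥0 → X) (ψ : ℝ≥0 → Z) :
    Prod.fst '' limitSet (fun t => (φ t, ψ t)) = limitSet φ := by
  ext x
  constructor
  · rintro ⟨p, hp, rfl⟩
    rw [mem_limitSet_iff] at hp ⊢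
    exact hp.continuousAt_comp continuous_fst.continuousAt
  · intro hx
    rw [mem_limitSet_iff, MapClusterPt, ClusterPt] at hx
    -- Along times at which `φ` is near `x`, compactness gives a cluster point of the pairs, and its
    -- first coordinate must be `x`.
    have h1 : (atTop ⊓ comap φ (𝓝 x)).NeBot := by
      rw [inf_comm] at hx
      have : (map φ (atTop ⊓ comap φ (𝓝 x))).NeBot := by
        rwa [Filter.push_pull]
      exact Filter.map_neBot_iff _ |>.1 this
    obtain ⟨p, hp⟩ := exists_clusterPt_of_compactSpace
      (map (fun t => (φ t, ψ t)) (atTop ⊓ comap φ (𝓝 x)))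
    refine ⟨p, mem_limitSet_iff.2 (hp.mono (map_mono inf_le_left)), ?_⟩
    have h2 : MapClusterPt p.1 (atTop ⊓ comap φ (𝓝 x)) φ :=
      MapClusterPt.continuousAt_comp (f := Prod.fst) continuous_fst.continuousAt hp
    have h3 : ClusterPt p.1 (𝓝 x) := h2.clusterPt.mono
      ((map_mono inf_le_right).trans map_comap_le)
    exact eq_of_nhds_neBot h3

theorem subsingleton_of_isPreconnected_of_finite {Z : Type*} [TopologicalSpace Z] [T1Space Z]
    {s F : Set Z}
    (hs : IsPreconnected s) (hF : F.Finite) (hsF : s ⊆ F) : s.Subsingleton := by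
  intro a ha b hb
  by_contra hne
  have h := isPreconnected_closed_iff.1 hs {a} (F \ {a}) isClosed_singleton
    hF.sdiff.isClosed (fun x hx => by by_cases h : x = a <;> simp [h, hsF hx])
    ⟨a, ha, rfl⟩ ⟨b, hb, hsF hb, fun h => hne h.symm⟩
  obtain ⟨x, -, hx, hx'⟩ := h
  exact hx'.2 hx

instance : LocallyConnectedSpace ℝ≥0 := by
  refine locallyConnectedSpace_of_connected_bases (fun x r => Metric.ball x r) (fun _ r => 0 < r)
    (fun x => Metric.nhds_basis_ball) fun x r _ => ?_
  have : Metric.ball x r = ((↑) : ℝ≥0 → ℝ) ⁻¹' Metric.ball (x : ℝ) r := rfl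
  rw [isPreconnected_iff_ordConnected, this, Real.ball_eq_Ioo]
  exact ordConnected_Ioo.preimage_mono NNReal.coe_mono

/-- A subcontinuum of a limit set in `Class(W)` is not separated, by a finite-valued function that
is constant on the components of the visits of the ray, from the arcs of the ray near it. -/
theorem exists_forall_exists_dist_lt {X : Type u} [MetricSpace X] [CompactSpace X]
    {φ : ℝ≥0 → X} (hφ : Continuous φ) (hW : ClassW (limitSet φ)) {K : Set X}
    (hK : IsSubcontinuum K) (hKφ : K ⊆ limitSet φ) {W : Set ℝ≥0} (hW₀ : IsOpen W) {δ : ℝ}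
    (hδ : 0 < δ) (hKW : ∀ t, φ t ∈ Metric.cthickening δ K → t ∈ W) {D : Set X} (hD : D.Finite)
    (hDK : D ⊆ K) :
    ∃ t ∈ W, ∀ d ∈ D, ∃ s ∈ connectedComponentIn W t, dist (φ s) d < δ := by
  by_contra! hcon
  -- Every component of `W` misses some point of `D` by `δ`; `φ 0` is a dummy value for sets that
  -- are not components.
  have hpick : ∀ C : Set ℝ≥0, ∃ d, (∃ t ∈ W, C = connectedComponentIn W t) →
      d ∈ D ∧ ∀ s ∈ C, δ ≤ dist (φ s) d := by
    intro C
    by_cases h : ∃ t ∈ W, C = connectedComponentIn W t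
    · obtain ⟨t, ht, rfl⟩ := h
      obtain ⟨d, hd⟩ := hcon t ht
      exact ⟨d, fun _ => hd⟩
    · exact ⟨φ 0, fun h' => (h h').elim⟩
  choose pick hpick using hpick
  -- Labels are taken in `[0,1]`, so that Tietze's theorem can extend the labelling from the closed
  -- set `F ⊆ W` to all times. It is locally constant on `W` because components of `W` are open.
  obtain ⟨enc, henc⟩ : ∃ enc : X → unitInterval, InjOn enc D := by
    have : Finite D := hD
    obtain ⟨k, ⟨e⟩⟩ := Finite.exists_equiv_fin D
    have : Infinite unitInterval := Set.Icc.infinite (zero_lt_one' ℝ)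
    classical
    let g : D → unitInterval := fun d => Infinite.natEmbedding unitInterval (e d).val
    have hg : Function.Injective g := fun a b h =>
      e.injective (Fin.ext ((Infinite.natEmbedding unitInterval).injective h))
    refine ⟨fun x => if h : x ∈ D then g ⟨x, h⟩ else 0, fun a ha b hb h => ?_⟩
    simp only [ha, hb, dif_pos] at h
    exact congrArg Subtype.val (hg h)
  set F : Set ℝ≥0 := φ ⁻¹' Metric.cthickening δ K with hF
  have hFc : IsClosed F := Metric.isClosed_cthickening.preimage hφ
  let ψ₀ : ℝ≥0 → unitInterval := fun t => enc (pick (connectedComponentIn W t))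
  have hψ₀ : ContinuousOn ψ₀ W := by
    intro t ht
    have h1 : connectedComponentIn W t ∈ 𝓝 t :=
      hW₀.connectedComponentIn.mem_nhds (mem_connectedComponentIn ht)
    refine ContinuousAt.continuousWithinAt ?_
    refine (continuousAt_const (y := ψ₀ t)).congr ?_
    filter_upwards [h1] with s hs
    simp only [ψ₀, connectedComponentIn_eq hs]
  obtain ⟨ψ, hψ⟩ := ContinuousMap.exists_restrict_eq (Y := unitInterval) hFc
    ⟨F.domRestrict ψ₀, (hψ₀.mono hKW).domRestrict⟩
  have hψ' : ∀ t ∈ F, ψ t = ψ₀ t := fun t ht => by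
    have := congrArg (fun g : C(F, unitInterval) => g ⟨t, ht⟩) hψ
    exact this
  let Θ : ℝ≥0 → X × unitInterval := fun t => (φ t, ψ t)
  have hΘ : Continuous Θ := hφ.prodMk ψ.continuous
  have hfst : Prod.fst '' limitSet Θ = limitSet φ := fst_image_limitSet φ ψ
  have hScont : IsContinuum (limitSet Θ) := by
    refine ⟨isCompact_iff_compactSpace.1 isClosed_limitSet.isCompact,
      isConnected_iff_connectedSpace.1 (isConnected_limitSet hΘ), inferInstance⟩
  let f : limitSet Θ → limitSet φ := fun p => ⟨p.1.1, hfst ▸ mem_image_of_mem _ p.2⟩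
  have hf : Continuous f := by fun_prop
  have hfs : Function.Surjective f := by
    rintro ⟨x, hx⟩
    rw [← hfst] at hx
    obtain ⟨p, hp, rfl⟩ := hx
    exact ⟨⟨p, hp⟩, rfl⟩
  have hK' : IsSubcontinuum (Subtype.val ⁻¹' K : Set (limitSet φ)) := by
    refine ⟨isClosed_limitSet.isClosedEmbedding_subtypeVal.isCompact_preimage hK.1, ?_⟩
    refine hK.2.preimage_of_isClosedMap Subtype.val_injective
      isClosed_limitSet.isClosedEmbedding_subtypeVal.isClosedMap ?_
    simpa using hKφ
  obtain ⟨C, hC, hCK⟩ := hW.weaklyConfluent _ hScont f hf hfs _ hK'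
  -- A closed set containing `Θ t` for every `t ∈ F`, hence all points of the lifted limit set that
  -- lie over `K`.
  let Q : Set (X × unitInterval) := ⋃ d ∈ D, {p | p.2 = enc d ∧ δ ≤ dist p.1 d}
  have hQ : IsClosed Q := hD.isClosed_biUnion fun d _ =>
    (isClosed_eq continuous_snd continuous_const).inter
      (isClosed_le continuous_const (continuous_fst.dist continuous_const))
  have hQF : ∀ t ∈ F, Θ t ∈ Q := by
    intro t ht
    have h1 := hpick (connectedComponentIn W t) ⟨t, hKW t ht, rfl⟩
    simp only [Q, mem_iUnion]
    exact ⟨_, h1.1, hψ' t ht, h1.2 t (mem_connectedComponentIn (hKW t ht))⟩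
  have hCQ : ∀ p ∈ C, p.1 ∈ Q := by
    intro p hp
    have hpK : p.1.1 ∈ K := by
      have : f p ∈ f '' C := mem_image_of_mem f hp
      rw [hCK] at this
      exact this
    have h1 := mem_limitSet_iff.1 p.2
    have hnhds : Metric.thickening δ K ∈ 𝓝 p.1.1 :=
      Metric.isOpen_thickening.mem_nhds (Metric.self_subset_thickening hδ K hpK)
    have h2 : p.1 ∈ closure (Θ '' F) := by
      rw [mem_closure_iff_nhds]
      intro s hs
      obtain ⟨t, ht⟩ := (mapClusterPt_iff_frequently.1 h1 _
        (inter_mem hs (continuous_fst.continuousAt hnhds))).exists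
      exact ⟨Θ t, ht.1, t, Metric.thickening_subset_cthickening _ _ ht.2, rfl⟩
    have h3 : closure (Θ '' F) ⊆ Q := closure_minimal (image_subset_iff.2 hQF) hQ
    exact h3 h2
  -- The label takes finitely many values on the connected set `C`, so it is constant.
  have hsub : ((fun p : limitSet Θ => p.1.2) '' C).Subsingleton := by
    refine subsingleton_of_isPreconnected_of_finite (hC.2.isPreconnected.image _ (by fun_prop))
      (hD.image enc) ?_
    rintro _ ⟨p, hp, rfl⟩
    have := hCQ p hp
    simp only [Q, mem_iUnion] at this
    obtain ⟨d, hd, h, -⟩ := this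
    exact ⟨d, hd, h.symm⟩
  obtain ⟨p, hp⟩ := hC.2.nonempty
  have h1 := hCQ p hp
  simp only [Q, mem_iUnion] at h1
  obtain ⟨d, hd, hpd, -⟩ := h1
  -- The missed point `d` lies in `K`, so some `q ∈ C` lies over it; membership of `q` in `Q` puts
  -- `d` at distance at least `δ` from itself.
  have hd' : (⟨d, hKφ (hDK hd)⟩ : limitSet φ) ∈ f '' C := by rw [hCK]; exact hDK hd
  obtain ⟨q, hq, hqd⟩ := hd'
  have hqd' : q.1.1 = d := congrArg Subtype.val hqd
  have h2 := hCQ q hq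
  simp only [Q, mem_iUnion] at h2
  obtain ⟨d', hd', hpd', h3⟩ := h2
  have : d = d' := henc hd hd' (by
    rw [← hpd, ← hpd']
    exact hsub (mem_image_of_mem _ hp) (mem_image_of_mem _ hq))
  rw [hqd', this, dist_self] at h3
  exact absurd h3 (not_le.2 hδ)

/-- If the limit set of a ray is in `Class(W)`, all its subcontinua are limits of arcs of the
ray. -/
theorem exists_hausdorffDist_image_Icc_lt {X : Type u} [MetricSpace X] [CompactSpace X]
    {φ : ℝ≥0 → X} (hφ : Continuous φ) (hW : ClassW (limitSet φ)) {K : Set X}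
    (hK : IsSubcontinuum K) (hKφ : K ⊆ limitSet φ) {ε : ℝ} (hε : 0 < ε) :
    ∃ a b, a < b ∧ Metric.hausdorffDist K (φ '' Icc a b) < ε := by
  obtain ⟨D, hDK, hD, hcov⟩ := hK.1.finite_cover_balls (show 0 < ε / 4 by positivity)
  -- Staying in one component of `W` keeps the arc within `ε / 2` of `K`; passing within `ε / 4` of
  -- each point of an `ε / 4`-net gives the other half of the Hausdorff estimate.
  set W : Set ℝ≥0 := φ ⁻¹' Metric.thickening (ε / 2) K with hWdef
  have hW₀ : IsOpen W := Metric.isOpen_thickening.preimage hφ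
  obtain ⟨t, ht, hs⟩ := exists_forall_exists_dist_lt hφ hW hK hKφ hW₀
    (show 0 < ε / 4 by positivity)
    (fun t ht => Metric.cthickening_subset_thickening' (by positivity) (by linarith) _ ht) hD hDK
  set C := connectedComponentIn W t with hCdef
  have hCo : IsOpen C := hW₀.connectedComponentIn
  have htC : t ∈ C := mem_connectedComponentIn ht
  have hCord : C.OrdConnected := isPreconnected_connectedComponentIn.ordConnected
  -- A second time in the component makes the interval nondegenerate.
  obtain ⟨t', htt', ht'C⟩ : ∃ t', t < t' ∧ t' ∈ C := by
    obtain ⟨u, hu, hu'⟩ := exists_Ico_subset_of_mem_nhds (hCo.mem_nhds htC) (exists_gt t)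
    obtain ⟨v, hv, hv'⟩ := exists_between hu
    exact ⟨v, hv, hu' ⟨hv.le, hv'⟩⟩
  choose! s hsC hsd using hs
  let T : Finset ℝ≥0 := insert t (insert t' (hD.toFinset.image s))
  have hTne : T.Nonempty := Finset.insert_nonempty _ _
  have hTC : ∀ x ∈ T, x ∈ C := by
    intro x hx
    simp only [T, Finset.mem_insert, Finset.mem_image, Set.Finite.mem_toFinset] at hx
    rcases hx with rfl | rfl | ⟨d, hd, rfl⟩
    exacts [htC, ht'C, hsC d hd]
  have hle : ∀ x ∈ T, x ∈ Icc (T.min' hTne) (T.max' hTne) := fun x hx =>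
    ⟨T.min'_le x hx, T.le_max' x hx⟩
  have htT : t ∈ T := Finset.mem_insert_self _ _
  have htT' : t' ∈ T := Finset.mem_insert_of_mem (Finset.mem_insert_self _ _)
  refine ⟨T.min' hTne, T.max' hTne, ((hle t htT).1.trans_lt htt').trans_le (hle t' htT').2, ?_⟩
  have hsubC : Icc (T.min' hTne) (T.max' hTne) ⊆ C :=
    hCord.out (hTC _ (T.min'_mem _)) (hTC _ (T.max'_mem _))
  refine (Metric.hausdorffDist_le_of_mem_dist (r := ε / 2) (by positivity) ?_ ?_).trans_lt
    (by linarith)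
  · intro k hk
    obtain ⟨d, hd, hkd⟩ := mem_iUnion₂.1 (hcov hk)
    refine ⟨φ (s d), mem_image_of_mem _ (hle _ ?_), ?_⟩
    · simp only [T, Finset.mem_insert, Finset.mem_image, Set.Finite.mem_toFinset]
      exact Or.inr (Or.inr ⟨d, hd, rfl⟩)
    · have h1 := hsd d hd
      rw [Metric.mem_ball] at hkd
      have := dist_triangle_right k (φ (s d)) d
      linarith
  · rintro _ ⟨x, hx, rfl⟩
    have hxW : x ∈ W := connectedComponentIn_subset _ _ (hsubC hx)
    obtain ⟨k, hk, hkx⟩ := Metric.mem_thickening_iff.1 hxW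
    exact ⟨k, hk, hkx.le⟩

/-! ### Recognition of topological graphs -/

/-- A ray whose limit set lies in a finite set converges. -/
theorem exists_tendsto_of_limitSet_subset {Y : Type*} [TopologicalSpace Y] [CompactSpace Y]
    [T2Space Y] {ρ : ℝ≥0 → Y} (hρ : Continuous ρ) {V : Set Y} (hV : V.Finite)
    (h : limitSet ρ ⊆ V) : ∃ v ∈ V, Tendsto ρ atTop (𝓝 v) := by
  obtain ⟨v, hv⟩ := limitSet_nonempty (φ := ρ)
  refine ⟨v, h hv, ?_⟩
  have hs := subsingleton_of_isPreconnected_of_finite (isConnected_limitSet hρ).isPreconnected hV h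
  rw [tendsto_nhds]
  intro U hU hvU
  exact eventually_mem_of_limitSet_subset hU fun x hx => hs hv hx ▸ hvU

open scoped ENNReal in
/-- A convergent injective ray that does not meet its limit closes up to an arc. -/
theorem exists_isEmbedding_of_ray {Y : Type*} [TopologicalSpace Y] [T2Space Y]
    {ρ : ℝ≥0 → Y} (hρ : Continuous ρ) (hinj : Function.Injective ρ) {v : Y}
    (hlim : Tendsto ρ atTop (𝓝 v)) (hv : v ∉ range ρ) :
    ∃ e : unitInterval → Y, IsEmbedding e ∧ e 1 = v ∧ e 0 = ρ 0 ∧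
      (∀ s, s ≠ 1 → ∃ t, e s = ρ t ∧ (t = 0 → s = 0)) ∧ range e = range ρ ∪ {v} := by
  -- Extended by its limit, the ray becomes a continuous injection of the compact interval `[0,∞]`.
  let g : ℝ≥0∞ → Y := fun x => if x = ∞ then v else ρ x.toNNReal
  have hg_coe : ∀ t : ℝ≥0, g t = ρ t := fun t => by simp [g]
  have hg_top : g ∞ = v := by simp [g]
  have hg : Continuous g := by
    rw [continuous_iff_continuousAt]
    intro x
    induction x with
    | top =>
      rw [ContinuousAt, hg_top, tendsto_nhds]
      intro U hU hvU
      obtain ⟨m, hm⟩ := eventually_atTop.1 (hlim (hU.mem_nhds hvU))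
      refine ENNReal.nhds_top_basis.mem_iff.2 ⟨m, ENNReal.coe_lt_top, ?_⟩
      intro x hx
      induction x with
      | top => simpa [hg_top] using hvU
      | coe x =>
        have : m < x := ENNReal.coe_lt_coe.1 hx
        simpa [hg_coe] using hm x this.le
    | coe x =>
      rw [← ENNReal.isOpenEmbedding_coe.continuousAt_iff]
      have : g ∘ ENNReal.ofNNReal = ρ := funext hg_coe
      rw [this]
      exact hρ.continuousAt
  have hg_inj : Function.Injective g := by
    intro x y hxy
    induction x with
    | top =>
      induction y with
      | top => rfl
      | coe y => rw [hg_top, hg_coe] at hxy; exact (hv ⟨y, hxy.symm⟩).elim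
    | coe x =>
      induction y with
      | top => rw [hg_top, hg_coe] at hxy; exact (hv ⟨x, hxy⟩).elim
      | coe y => rw [hg_coe, hg_coe] at hxy; rw [hinj hxy]
  let o := ENNReal.orderIsoUnitIntervalBirational
  refine ⟨g ∘ o.symm, ?_, ?_, ?_, ?_, ?_⟩
  · exact ((hg.comp o.symm.continuous).isClosedEmbedding
      (hg_inj.comp o.symm.injective)).isEmbedding
  · have : o.symm 1 = ∞ := o.symm.map_top
    simp [this, hg_top]
  · have : o.symm 0 = ((0 : ℝ≥0) : ℝ≥0∞) := o.symm.map_bot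
    simp only [Function.comp_apply, this, hg_coe]
  · intro s hs
    have h1 : o.symm s ≠ ∞ := fun h => hs (by
      have : o.symm s = o.symm 1 := h.trans o.symm.map_top.symm
      exact o.symm.injective this)
    refine ⟨(o.symm s).toNNReal, ?_, fun h => ?_⟩
    · simp only [Function.comp_apply]
      conv_lhs => rw [← ENNReal.coe_toNNReal h1]
      exact hg_coe _
    · apply o.symm.injective
      have : o.symm 0 = 0 := o.symm.map_bot
      rw [this, ← ENNReal.coe_toNNReal h1, h]; rfl
  · rw [o.symm.surjective.range_comp]
    ext y
    constructor
    · rintro ⟨x, rfl⟩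
      induction x with
      | top => right; exact hg_top
      | coe x => left; exact ⟨x, (hg_coe x).symm⟩
    · rintro (⟨x, rfl⟩ | rfl)
      · exact ⟨x, hg_coe x⟩
      · exact ⟨∞, hg_top⟩

/-- A nondegenerate continuum composed of a finite set and finitely many convergent rays that
meet only at their endpoints is a topological graph. -/
theorem isTopologicalGraph_of_rays {Y : Type*} [TopologicalSpace Y] [T2Space Y] [Nontrivial Y]
    (hY : IsContinuum Y) {ι : Type*} [Finite ι] {ρ : ι → ℝ≥0 → Y} {v : ι → Y}
    (hρ : ∀ k, Continuous (ρ k)) (hinj : ∀ k, Function.Injective (ρ k))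
    (hlim : ∀ k, Tendsto (ρ k) atTop (𝓝 (v k))) (hv : ∀ k l t, ρ l t ≠ v k)
    (hdisj : ∀ k l, k ≠ l → ∀ s t, ρ k s = ρ l t → s = 0 ∧ t = 0) {V : Set Y} (hV : V.Finite)
    (hcov : (⋃ k, range (ρ k)) ∪ V = univ) : IsTopologicalGraph Y := by
  refine ⟨hY, ?_⟩
  choose e he he1 he0 hes her using fun k =>
    exists_isEmbedding_of_ray (hρ k) (hinj k) (hlim k) (fun ⟨t, ht⟩ => hv k k t ht)
  -- A point on no edge would belong to `V` and be isolated, contrary to connectedness of a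
  -- nondegenerate space.
  have hun : (⋃ k, range (e k)) = univ := by
    by_contra hne
    obtain ⟨w, hw⟩ := (ne_univ_iff_exists_notMem _).1 hne
    have hcl : IsClosed ((⋃ k, range (e k)) ∪ V \ {w}) :=
      (isClosed_iUnion_of_finite fun k => (isCompact_range (he k).continuous).isClosed).union
        hV.sdiff.isClosed
    have hcompl : ({w} : Set Y)ᶜ = (⋃ k, range (e k)) ∪ V \ {w} := by
      ext y
      constructor
      · intro hy
        have : y ∈ (⋃ k, range (ρ k)) ∪ V := hcov ▸ mem_univ y
        rcases this with h | h
        · left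
          obtain ⟨k, hk⟩ := mem_iUnion.1 h
          exact mem_iUnion.2 ⟨k, by rw [her]; exact Or.inl hk⟩
        · exact Or.inr ⟨h, hy⟩
      · rintro (h | h) (rfl : y = w)
        · exact hw h
        · exact h.2 rfl
    have hop : IsOpen ({w} : Set Y) := by
      rw [← isClosed_compl_iff, hcompl]; exact hcl
    have := hY.connected
    have h1 := IsClopen.eq_univ ⟨isClosed_singleton, hop⟩ (singleton_nonempty w)
    obtain ⟨z, hz⟩ := exists_ne w
    exact hz (h1 ▸ mem_univ z : z ∈ ({w} : Set Y))
  obtain ⟨m, ⟨c⟩⟩ := Finite.exists_equiv_fin ι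
  refine ⟨m, fun i => e (c.symm i), fun i => he _, ?_, ?_⟩
  · rw [← hun]
    exact c.symm.surjective.iUnion_comp fun k => range (e k)
  · intro i j hij s t hst
    have hne : c.symm i ≠ c.symm j := fun h => hij (c.symm.injective h)
    by_cases hs : s = 1
    · by_cases ht : t = 1
      · exact ⟨Or.inr hs, Or.inr ht⟩
      · obtain ⟨x, hx, -⟩ := hes (c.symm j) t ht
        simp only [hs, he1, hx] at hst
        exact (hv _ _ _ hst.symm).elim
    · obtain ⟨x, hx, hx0⟩ := hes (c.symm i) s hs
      by_cases ht : t = 1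
      · simp only [ht, he1, hx] at hst
        exact (hv _ _ _ hst).elim
      · obtain ⟨y, hy, hy0⟩ := hes (c.symm j) t ht
        simp only [hx, hy] at hst
        have := hdisj _ _ hne _ _ hst
        exact ⟨Or.inl (hx0 this.1), Or.inl (hy0 this.2)⟩

/-- A nondegenerate continuum is a topological graph as soon as the complement of a finite set is
a finite disjoint union of open sets homeomorphic to the real line. -/
theorem isTopologicalGraph_of_openArcs {Y : Type*} [TopologicalSpace Y] [T2Space Y] [Nontrivial Y]
    (hY : IsContinuum Y) {ι : Type*} [Finite ι] {g : ι → ℝ → Y}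
    (hg : ∀ k, IsOpenEmbedding (g k)) (hdisj : ∀ k l, k ≠ l → Disjoint (range (g k)) (range (g l)))
    (hfin : (⋃ k, range (g k))ᶜ.Finite) : IsTopologicalGraph Y := by
  have := hY.compact
  -- The ray leaves a neighbourhood of each point of its own line and never enters the other lines,
  -- which are open. Its limit set is therefore in the finite complement.
  have hlim : ∀ (k : ι) (σ : ℝ≥0 → ℝ), Continuous σ →
      (∀ a : ℝ, ∃ O : Set ℝ, IsOpen O ∧ a ∈ O ∧ ∀ᶠ t in atTop, σ t ∉ O) →
      ∃ v ∈ (⋃ k, range (g k))ᶜ, Tendsto (fun t => g k (σ t)) atTop (𝓝 v) := by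
    intro k σ hσ hesc
    refine exists_tendsto_of_limitSet_subset ((hg k).continuous.comp hσ) hfin ?_
    intro x hx hx'
    obtain ⟨l, a, rfl⟩ := mem_iUnion.1 hx'
    have hx := mapClusterPt_iff_frequently.1 (mem_limitSet_iff.1 hx)
    by_cases hkl : k = l
    · subst hkl
      obtain ⟨O, hO, haO, hev⟩ := hesc a
      obtain ⟨t, ⟨b, hbO, hb⟩, ht⟩ := ((hx _ (((hg k).isOpenMap O hO).mem_nhds
        (mem_image_of_mem _ haO))).and_eventually hev).exists
      rw [(hg k).injective hb] at hbO
      exact ht hbO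
    · obtain ⟨t, ht⟩ := (hx _ ((hg l).isOpen_range.mem_nhds (mem_range_self a))).exists
      exact disjoint_left.1 (hdisj k l hkl) (mem_range_self _) ht
  -- Each line is cut at `0`, since a whole line may close up to a circle, whereas each half closes
  -- up to an arc.
  let sgn : Bool → ℝ≥0 → ℝ := fun b t => if b then (t : ℝ) else -(t : ℝ)
  have hsc : ∀ b, Continuous (sgn b) := by
    intro b
    cases b
    · exact NNReal.continuous_coe.neg
    · exact NNReal.continuous_coe
  have hsi : ∀ b, Function.Injective (sgn b) := by
    intro b s t h
    cases b <;> simpa [sgn] using h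
  have hesc : ∀ b, ∀ a : ℝ, ∃ O : Set ℝ, IsOpen O ∧ a ∈ O ∧ ∀ᶠ t in atTop, sgn b t ∉ O := by
    intro b a
    have h1 : Tendsto ((↑) : ℝ≥0 → ℝ) atTop atTop := NNReal.tendsto_coe_atTop.2 tendsto_id
    refine ⟨Ioo (a - 1) (a + 1), isOpen_Ioo, by simp, ?_⟩
    cases b
    · filter_upwards [h1.eventually_gt_atTop (1 - a)] with t ht h
      simp only [sgn, Bool.false_eq_true, if_false, mem_Ioo] at h
      linarith [h.1]
    · filter_upwards [h1.eventually_gt_atTop (a + 1)] with t ht h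
      simp only [sgn, if_true, mem_Ioo] at h
      linarith [h.2]
  choose v hvV hv using fun p : ι × Bool => hlim p.1 (sgn p.2) (hsc _) (hesc _)
  refine isTopologicalGraph_of_rays hY (ι := ι × Bool) (ρ := fun p t => g p.1 (sgn p.2 t)) (v := v)
    (fun p => (hg _).continuous.comp (hsc _)) (fun p => (hg _).injective.comp (hsi _)) hv ?_ ?_
    hfin ?_
  · intro k l t h
    exact hvV k (mem_iUnion.2 ⟨l.1, _, h⟩)
  · rintro ⟨k, b⟩ ⟨l, c⟩ hkl s t h
    have hkl' : k = l := by
      by_contra hne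
      exact disjoint_left.1 (hdisj k l hne) (mem_range_self _) ⟨_, h.symm⟩
    subst hkl'
    have h2 := (hg k).injective h
    have hs := s.coe_nonneg
    have ht := t.coe_nonneg
    have : (s : ℝ) = 0 ∧ (t : ℝ) = 0 := by
      cases b <;> cases c <;> simp [sgn] at h2 hkl ⊢
      · constructor <;> rw [← NNReal.coe_eq_zero] <;> linarith
      · constructor <;> rw [← NNReal.coe_eq_zero] <;> linarith
    exact_mod_cast this
  · rw [eq_univ_iff_forall]
    intro y
    by_cases hy : y ∈ ⋃ k, range (g k)
    · left
      obtain ⟨k, a, rfl⟩ := mem_iUnion.1 hy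
      rcases le_total 0 a with ha | ha
      · exact mem_iUnion.2 ⟨(k, true), ⟨a, ha⟩, rfl⟩
      · exact mem_iUnion.2 ⟨(k, false), ⟨-a, by linarith⟩, congrArg (g k) (neg_neg a)⟩
    · exact Or.inr hy

/-! ### Closed images of compact spaces -/

section ClosedMap

variable {X Y : Type*} [TopologicalSpace X] [TopologicalSpace Y] {π : X → Y}

/-- Neighbourhoods of a fibre of a closed map contain the preimage of a neighbourhood. -/
theorem exists_isOpen_preimage_subset (hcl : IsClosedMap π) {y : Y} {U : Set X} (hU : IsOpen U)
    (h : π ⁻¹' {y} ⊆ U) : ∃ O : Set Y, IsOpen O ∧ y ∈ O ∧ π ⁻¹' O ⊆ U := by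
  refine ⟨kernImage π U, isClosedMap_iff_kernImage.1 hcl hU, fun x hx => h hx, fun x hx => hx rfl⟩

theorem t2Space_of_isClosedMap [CompactSpace X] [T2Space X] (hc : Continuous π)
    (hcl : IsClosedMap π) (hs : Function.Surjective π) : T2Space Y := by
  have hfib : ∀ y, IsClosed (π ⁻¹' {y}) := fun y => by
    obtain ⟨x, rfl⟩ := hs y
    have : IsClosed ({π x} : Set Y) := by simpa using hcl {x} isClosed_singleton
    exact this.preimage hc
  refine ⟨fun y z hyz => ?_⟩
  obtain ⟨U, V, hU, hV, hyU, hzV, hUV⟩ := normal_separation (hfib y) (hfib z)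
    (Disjoint.preimage π (disjoint_singleton.2 hyz))
  obtain ⟨O, hO, hyO, hOU⟩ := exists_isOpen_preimage_subset hcl hU hyU
  obtain ⟨P, hP, hzP, hPV⟩ := exists_isOpen_preimage_subset hcl hV hzV
  refine ⟨O, P, hO, hP, hyO, hzP, disjoint_left.2 fun w hwO hwP => ?_⟩
  obtain ⟨x, rfl⟩ := hs w
  exact disjoint_left.1 hUV (hOU hwO) (hPV hwP)

/-- Kernel images of finite unions of basic open sets form a base; finite unions suffice because the
fibres are compact. -/
theorem secondCountableTopology_of_isClosedMap [CompactSpace X] [T2Space X]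
    [SecondCountableTopology X] (hc : Continuous π)
    (hcl : IsClosedMap π) (hs : Function.Surjective π) : SecondCountableTopology Y := by
  have := t2Space_of_isClosedMap hc hcl hs
  let B := TopologicalSpace.countableBasis X
  let 𝒮 : Set (Set Y) := (fun F : Set (Set X) => kernImage π (⋃₀ F)) '' {F | F.Finite ∧ F ⊆ B}
  have hS : 𝒮.Countable :=
    (Set.countable_ofPred_finite_subset (TopologicalSpace.countable_countableBasis X)).image _
  have hB : TopologicalSpace.IsTopologicalBasis 𝒮 := by
    refine TopologicalSpace.isTopologicalBasis_of_isOpen_of_nhds ?_ ?_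
    · rintro _ ⟨F, ⟨-, hF⟩, rfl⟩
      exact isClosedMap_iff_kernImage.1 hcl (isOpen_sUnion fun s hs =>
        TopologicalSpace.isOpen_of_mem_countableBasis (hF hs))
    · intro y O hyO hO
      have hK : IsCompact (π ⁻¹' {y}) := (isClosed_singleton.preimage hc).isCompact
      have hKO : π ⁻¹' {y} ⊆ π ⁻¹' O := preimage_mono (singleton_subset_iff.2 hyO)
      obtain ⟨F, hFsub, hF, hKF⟩ := hK.elim_finite_subcover_image
        (b := {s | s ∈ B ∧ s ⊆ π ⁻¹' O}) (c := id)
        (fun s hs => TopologicalSpace.isOpen_of_mem_countableBasis hs.1) (by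
          intro x hx
          obtain ⟨s, hs, hxs, hsO⟩ :=
            (TopologicalSpace.isBasis_countableBasis X).exists_subset_of_mem_open
            (hKO hx) (hO.preimage hc)
          exact mem_iUnion₂.2 ⟨s, ⟨hs, hsO⟩, hxs⟩)
      refine ⟨_, ⟨F, ⟨hF, fun s hs => (hFsub hs).1⟩, rfl⟩, ?_, ?_⟩
      · intro x hx
        obtain ⟨s, hs, hxs⟩ := mem_iUnion₂.1 (hKF hx)
        exact ⟨s, hs, hxs⟩
      · intro z hz
        obtain ⟨x, rfl⟩ := hs z
        obtain ⟨s, hs, hxs⟩ := hz rfl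
        exact (hFsub hs).2 hxs
  exact hB.secondCountableTopology hS

end ClosedMap

/-! ### The collapsing quotient -/

section Collapse

variable {X : Type*} [TopologicalSpace X] {W : Set X}

theorem subset_of_mem_componentsOf {Λ : Set X} (h : Λ ∈ componentsOf W) : Λ ⊆ W := by
  obtain ⟨x, -, rfl⟩ := h
  exact connectedComponentIn_subset _ _

theorem isConnected_of_mem_componentsOf {Λ : Set X} (h : Λ ∈ componentsOf W) :
    IsConnected Λ := by
  obtain ⟨x, hx, rfl⟩ := h
  exact isConnected_connectedComponentIn_iff.2 hx

theorem eq_of_mem_componentsOf {Λ Λ' : Set X} (h : Λ ∈ componentsOf W) (h' : Λ' ∈ componentsOf W)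
    {x : X} (hx : x ∈ Λ) (hx' : x ∈ Λ') : Λ = Λ' := by
  obtain ⟨y, -, rfl⟩ := h
  obtain ⟨z, -, rfl⟩ := h'
  rw [connectedComponentIn_eq hx, connectedComponentIn_eq hx']

theorem subset_of_isPreconnected {Λ C : Set X} (h : Λ ∈ componentsOf W) (hC : IsPreconnected C)
    (hCW : C ⊆ W) {x : X} (hx : x ∈ Λ) (hx' : x ∈ C) : C ⊆ Λ := by
  obtain ⟨y, -, rfl⟩ := h
  rw [connectedComponentIn_eq hx]
  exact hC.subset_connectedComponentIn hx' hCW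

theorem mk_collapse_eq_iff {a b : X} :
    (Quotient.mk (collapse W) a = Quotient.mk (collapse W) b) ↔
      a = b ∨ ∃ Λ ∈ componentsOf W, a ∈ Λ ∧ b ∈ Λ := Quotient.eq

theorem preimage_mk_collapse_of_mem {Λ : Set X} (h : Λ ∈ componentsOf W) {x : X} (hx : x ∈ Λ) :
    Quotient.mk (collapse W) ⁻¹' {Quotient.mk (collapse W) x} = Λ := by
  ext y
  rw [mem_preimage, mem_singleton_iff, mk_collapse_eq_iff]
  constructor
  · rintro (rfl | ⟨Λ', hΛ', hy, hx'⟩)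
    · exact hx
    · rwa [eq_of_mem_componentsOf h hΛ' hx hx']
  · exact fun hy => Or.inr ⟨Λ, h, hy, hx⟩

theorem preimage_mk_collapse_of_notMem {x : X} (hx : x ∉ W) :
    Quotient.mk (collapse W) ⁻¹' {Quotient.mk (collapse W) x} = {x} := by
  ext y
  rw [mem_preimage, mem_singleton_iff, mk_collapse_eq_iff, mem_singleton_iff]
  refine ⟨?_, Or.inl⟩
  rintro (h | ⟨Λ', hΛ', -, hx'⟩)
  · exact h
  · exact (hx (subset_of_mem_componentsOf hΛ' hx')).elim

theorem mem_component {x : X} (hx : x ∈ W) :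
    connectedComponentIn W x ∈ componentsOf W ∧ x ∈ connectedComponentIn W x :=
  ⟨⟨x, hx, rfl⟩, mem_connectedComponentIn hx⟩

theorem preimage_image_mk_collapse {C : Set X} (hC : Disjoint C W) :
    Quotient.mk (collapse W) ⁻¹' (Quotient.mk (collapse W) '' C) = C := by
  refine subset_antisymm ?_ (subset_preimage_image _ _)
  rintro x ⟨c, hc, hcx⟩
  have : x ∈ Quotient.mk (collapse W) ⁻¹' {Quotient.mk (collapse W) c} := hcx.symm
  rw [preimage_mk_collapse_of_notMem (disjoint_left.1 hC hc)] at this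
  rwa [mem_singleton_iff.1 this]

/-- Saturating a closed set adds only the components that it meets, finitely many closed sets. -/
theorem isClosedMap_mk_collapse (hfin : (componentsOf W).Finite)
    (hcl : ∀ Λ ∈ componentsOf W, IsClosed Λ) : IsClosedMap (Quotient.mk (collapse W)) := by
  intro C hC
  rw [← isQuotientMap_quotient_mk'.isClosed_preimage]
  have : Quotient.mk (collapse W) ⁻¹' (Quotient.mk (collapse W) '' C) =
      C ∪ ⋃ Λ ∈ {Λ ∈ componentsOf W | (C ∩ Λ).Nonempty}, Λ := by
    ext x
    simp only [mem_preimage, mem_image, mk_collapse_eq_iff, mem_union, mem_iUnion, mem_ofPred_eq,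
      exists_prop]
    constructor
    · rintro ⟨c, hc, rfl | ⟨Λ, hΛ, hcΛ, hx⟩⟩
      · exact Or.inl hc
      · exact Or.inr ⟨Λ, ⟨hΛ, c, hc, hcΛ⟩, hx⟩
    · rintro (hx | ⟨Λ, ⟨hΛ, c, hc, hcΛ⟩, hx⟩)
      · exact ⟨x, hx, Or.inl rfl⟩
      · exact ⟨c, hc, Or.inr ⟨Λ, hΛ, hcΛ, hx⟩⟩
  change IsClosed (Quotient.mk (collapse W) ⁻¹' (Quotient.mk (collapse W) '' C))
  rw [this]
  exact hC.union ((hfin.subset (sep_subset _ _)).isClosed_biUnion fun Λ hΛ => hcl Λ hΛ.1)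

theorem isOpenEmbedding_mk_collapse_comp {Z : Type*} [TopologicalSpace Z] {g : Z → X}
    (hg : IsOpenEmbedding g) (hgW : Disjoint (range g) W) :
    IsOpenEmbedding (Quotient.mk (collapse W) ∘ g) := by
  refine IsOpenEmbedding.of_continuous_injective_isOpenMap
    (continuous_quotient_mk'.comp hg.continuous) ?_ ?_
  · intro a b hab
    have : g b ∈ Quotient.mk (collapse W) ⁻¹' {Quotient.mk (collapse W) (g a)} := hab.symm
    rw [preimage_mk_collapse_of_notMem (disjoint_left.1 hgW (mem_range_self a))] at this
    exact hg.injective this.symm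
  · intro O hO
    rw [image_comp, ← isQuotientMap_quotient_mk'.isOpen_preimage]
    change IsOpen (Quotient.mk (collapse W) ⁻¹' _)
    rw [preimage_image_mk_collapse (hgW.mono_left (image_subset_range _ _))]
    exact hg.isOpenMap O hO

end Collapse

/-! ### Rays inside rays, arcs and graphs -/

section Rays

variable {X : Type*} [TopologicalSpace X]

theorem limitSet_shift (φ : ℝ≥0 → X) (m : ℝ≥0) : limitSet (fun t => φ (m + t)) = limitSet φ := by
  ext x
  rw [mem_limitSet_iff, mem_limitSet_iff]
  constructor
  · exact fun h => MapClusterPt.of_comp (tendsto_atTop_mono (fun _ => le_add_self) tendsto_id) h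
  · intro h
    rw [mapClusterPt_iff_frequently] at h ⊢
    intro s hs
    rw [frequently_atTop]
    intro a
    obtain ⟨t, ht, hts⟩ := frequently_atTop.1 (h s hs) (m + a)
    refine ⟨t - m, le_tsub_of_add_le_left ht, ?_⟩
    rwa [add_tsub_cancel_of_le (le_self_add.trans ht)]

/-- A point off the limit set has a neighbourhood missed by a tail, and the remaining initial
segment is compact. -/
theorem IsQuasiArc.isEmbedding [CompactSpace X] [T2Space X] {φ : ℝ≥0 → X} (hφ : IsQuasiArc φ)
    (hd : Disjoint (limitSet φ) (range φ)) : IsEmbedding φ := by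
  refine ⟨⟨?_⟩, hφ.injective⟩
  refine TopologicalSpace.ext_nhds fun t => ?_
  rw [nhds_induced]
  refine le_antisymm (hφ.continuous.tendsto t).le_comap ?_
  intro N hN
  obtain ⟨O, hON, hO, htO⟩ := mem_nhds_iff.1 hN
  have h1 : φ t ∉ limitSet φ := fun h => disjoint_left.1 hd h (mem_range_self t)
  simp only [limitSet, mem_iInter, not_forall] at h1
  obtain ⟨m, hm⟩ := h1
  have hC : IsClosed (φ '' (Icc 0 m \ O)) :=
    ((isCompact_Icc.diff hO).image hφ.continuous).isClosed
  refine mem_comap.2 ⟨(φ '' (Icc 0 m \ O))ᶜ ∩ (closure (φ '' Ici m))ᶜ, ?_, ?_⟩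
  · refine (hC.isOpen_compl.inter isClosed_closure.isOpen_compl).mem_nhds ⟨?_, hm⟩
    rintro ⟨s, hs, hst⟩
    exact hs.2 (hφ.injective hst ▸ htO)
  · rintro s ⟨h1, h2⟩
    by_contra hs
    rcases le_total s m with hsm | hsm
    · exact h1 ⟨s, ⟨⟨zero_le, hsm⟩, fun h => hs (hON h)⟩, rfl⟩
    · exact h2 (subset_closure ⟨s, hsm, rfl⟩)

/-- By the intermediate value theorem, each `A u` with `u ≥ τ m` is visited by `A ∘ τ` at some time
after `m`. -/
theorem limitSet_comp_eq {A : ℝ≥0 → X} {τ : ℝ≥0 → ℝ≥0} (hτ : Continuous τ)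
    (ht : Tendsto τ atTop atTop) : limitSet (A ∘ τ) = limitSet A := by
  refine subset_antisymm (limitSet_comp_subset ht) fun x hx => ?_
  refine mem_iInter.2 fun m => closure_mono ?_ (mem_iInter.1 hx (τ m))
  rintro _ ⟨u, hu, rfl⟩
  obtain ⟨b, hb, hb'⟩ := ((ht.eventually_ge_atTop u).and (eventually_ge_atTop m)).exists
  obtain ⟨x, hx, rfl⟩ := intermediate_value_Icc hb' hτ.continuousOn ⟨hu, hb⟩
  exact ⟨x, hx.1, rfl⟩

/-- A reparametrized ray has the same limit set, or converges to a point of the ray different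
from its endpoint. -/
theorem limitSet_comp_of_strictMono {A : ℝ≥0 → X} (hA : Continuous A) {τ : ℝ≥0 → ℝ≥0}
    (hτ : Continuous τ) (hm : StrictMono τ) :
    limitSet (A ∘ τ) = limitSet A ∨ ∃ c, 0 < c ∧ Tendsto (A ∘ τ) atTop (𝓝 (A c)) := by
  rcases tendsto_atTop_of_monotone hm.monotone with h | ⟨c, hc⟩
  · exact Or.inl (limitSet_comp_eq hτ h)
  · right
    refine ⟨c, ?_, (hA.tendsto c).comp hc⟩
    have : τ 1 ≤ c := hm.monotone.ge_of_tendsto hc 1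
    exact (zero_le.trans_lt (hm zero_lt_one)).trans_le this

theorem exists_lift {Z T : Type*} [TopologicalSpace Z] [TopologicalSpace T] {A : T → X}
    (hA : IsEmbedding A) {ψ : Z → X} (hψ : Continuous ψ) (hi : Function.Injective ψ)
    (h : ∀ t, ψ t ∈ range A) : ∃ τ : Z → T, Continuous τ ∧ Function.Injective τ ∧ ψ = A ∘ τ := by
  choose τ hτ using h
  have he : ψ = A ∘ τ := funext fun t => (hτ t).symm
  refine ⟨τ, ?_, ?_, he⟩
  · rw [hA.continuous_iff, ← he]; exact hψ
  · rw [he] at hi; exact hi.of_comp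

/-- The ray is `A ∘ τ` with `τ` strictly monotone. Unless `τ` tends to infinity it converges, and
then the ray converges too and is not oscillatory. -/
theorem limitSet_eq_of_range_subset [T2Space X] {A : ℝ≥0 → X} (hA : IsEmbedding A) {ψ : ℝ≥0 → X}
    (hψ : IsQuasiArc ψ) (h : ∀ t, ψ t ∈ range A) (hnt : IsOscillatory ψ) :
    limitSet ψ = limitSet A := by
  obtain ⟨τ, hτ, hi, rfl⟩ := exists_lift hA hψ.continuous hψ.injective h
  have hno : ∀ c, ¬ Tendsto (A ∘ τ) atTop (𝓝 (A c)) := fun c hc => by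
    have := limitSet_eq_singleton hc
    rw [IsOscillatory, this] at hnt
    exact not_nontrivial_singleton hnt
  rcases hτ.strictMono_of_inj hi with hm | hm
  · exact (limitSet_comp_of_strictMono hA.continuous hτ hm).resolve_right
      fun ⟨c, _, hc⟩ => hno c hc
  · exfalso
    rcases tendsto_atTop_of_antitone hm.antitone with h | ⟨c, hc⟩
    · rw [OrderBot.atBot_eq] at h
      exact hno ⊥ ((hA.continuous.tendsto ⊥).comp (h.mono_right (pure_le_nhds _)))
    · exact hno c ((hA.continuous.tendsto c).comp hc)

/-- A ray in an arc converges. -/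
theorem not_isOscillatory_of_range_subset_arc [T2Space X] {e : unitInterval → X}
    (he : IsEmbedding e) {ψ : ℝ≥0 → X} (hψ : IsQuasiArc ψ) (h : ∀ t, ψ t ∈ range e) :
    ¬ IsOscillatory ψ := by
  intro hnt
  obtain ⟨τ, hτ, hi, rfl⟩ := exists_lift he hψ.continuous hψ.injective h
  have hc : ∃ c, Tendsto τ atTop (𝓝 c) := by
    have hl : ∃ r : ℝ, Tendsto (fun t => (τ t : ℝ)) atTop (𝓝 r) := by
      rcases hτ.strictMono_of_inj hi with hm | hm
      · exact ⟨_, tendsto_atTop_ciSup (fun a b hab => hm.monotone hab)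
          ⟨1, by rintro _ ⟨t, rfl⟩; exact (τ t).2.2⟩⟩
      · exact ⟨_, tendsto_atTop_ciInf (fun a b hab => hm.antitone hab)
          ⟨0, by rintro _ ⟨t, rfl⟩; exact (τ t).2.1⟩⟩
    obtain ⟨r, hr⟩ := hl
    have hrI : r ∈ Icc (0 : ℝ) 1 :=
      isClosed_Icc.mem_of_tendsto hr (Eventually.of_forall fun t => (τ t).2)
    exact ⟨⟨r, hrI⟩, tendsto_subtype_rng.2 hr⟩
  obtain ⟨c, hc⟩ := hc
  have := limitSet_eq_singleton ((he.continuous.tendsto c).comp hc)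
  rw [IsOscillatory, this] at hnt
  exact not_nontrivial_singleton hnt

/-- A ray running through the interior of an interval towards one of its ends. -/
theorem exists_ray_Ioo {a b : ℝ≥0} (hab : a < b) :
    (∃ σ : ℝ≥0 → ℝ≥0, Continuous σ ∧ StrictMono σ ∧ (∀ t, σ t ∈ Ioo a b) ∧
      Tendsto σ atTop (𝓝 b)) ∧
    ∃ σ : ℝ≥0 → ℝ≥0, Continuous σ ∧ StrictAnti σ ∧ (∀ t, σ t ∈ Ioo a b) ∧
      Tendsto σ atTop (𝓝 a) := by
  have hab' : (0 : ℝ) < b - a := sub_pos.2 (NNReal.coe_lt_coe.2 hab)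
  -- The `2` keeps the quotient strictly below `b - a` even at `t = 0`.
  have h1 : Tendsto (fun t : ℝ≥0 => (b - a : ℝ) / (2 + t)) atTop (𝓝 0) :=
    tendsto_const_nhds.div_atTop
      (tendsto_atTop_add_const_left _ _ (NNReal.tendsto_coe_atTop.2 tendsto_id))
  have hpos : ∀ t : ℝ≥0, 0 < (b - a : ℝ) / (2 + t) := fun t => by positivity
  have hlt : ∀ t : ℝ≥0, (b - a : ℝ) / (2 + t) < b - a := fun t =>
    div_lt_self hab' (by have := t.coe_nonneg; linarith)
  have hanti : ∀ s t : ℝ≥0, s < t → (b - a : ℝ) / (2 + t) < (b - a : ℝ) / (2 + s) := fun s t h => by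
    have h' : (s : ℝ) < t := h
    gcongr
  have hcont : Continuous fun t : ℝ≥0 => (b - a : ℝ) / (2 + t) :=
    continuous_const.div (by fun_prop) fun t => by positivity
  have ha := a.coe_nonneg
  have hcoe : ∀ f : ℝ≥0 → ℝ, (∀ t, 0 ≤ f t) → ∀ t, ((f t).toNNReal : ℝ) = f t := fun f hf t =>
    Real.coe_toNNReal _ (hf t)
  constructor
  · have hc := hcoe (fun t => b - (b - a : ℝ) / (2 + t)) fun t => by linarith [hlt t]
    refine ⟨fun t => (b - (b - a : ℝ) / (2 + t)).toNNReal,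
      continuous_real_toNNReal.comp (continuous_const.sub hcont), fun s t h => ?_,
      fun t => ⟨?_, ?_⟩, ?_⟩
    · rw [← NNReal.coe_lt_coe, hc, hc]; linarith [hanti s t h]
    · rw [← NNReal.coe_lt_coe, hc]; linarith [hlt t]
    · rw [← NNReal.coe_lt_coe, hc]; linarith [hpos t]
    · rw [← NNReal.tendsto_coe]
      simp only [hc]
      simpa using h1.const_sub (b : ℝ)
  · have hc := hcoe (fun t => a + (b - a : ℝ) / (2 + t)) fun t => by linarith [hpos t]
    refine ⟨fun t => (a + (b - a : ℝ) / (2 + t)).toNNReal,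
      continuous_real_toNNReal.comp (continuous_const.add hcont), fun s t h => ?_,
      fun t => ⟨?_, ?_⟩, ?_⟩
    · rw [← NNReal.coe_lt_coe, hc, hc]; linarith [hanti s t h]
    · rw [← NNReal.coe_lt_coe, hc]; linarith [hpos t]
    · rw [← NNReal.coe_lt_coe, hc]; linarith [hlt t]
    · rw [← NNReal.tendsto_coe]
      simp only [hc]
      simpa using h1.const_add (a : ℝ)

/-- An injective path running inside an oscillatory ray leaves it at one end, at least, through
a point of the ray. -/
theorem exists_endpoint_mem_image [T2Space X] {A : ℝ≥0 → X} (hA : IsEmbedding A)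
    (hAo : IsOscillatory A) {φ : ℝ≥0 → X} (hφ : IsQuasiArc φ) {a b : ℝ≥0} (hab : a < b)
    (h : ∀ t ∈ Ioo a b, φ t ∈ range A) :
    ∃ c, 0 < c ∧ (φ a = A c ∨ φ b = A c) := by
  classical
  choose! τ hτ using h
  have hcont : ContinuousOn τ (Ioo a b) := by
    rw [hA.isInducing.continuousOn_iff]
    exact hφ.continuous.continuousOn.congr hτ
  have hinj : InjOn τ (Ioo a b) := fun x hx y hy hxy =>
    hφ.injective (by rw [← hτ x hx, ← hτ y hy, hxy])
  -- Consider the end towards which the `A`-coordinate `τ` increases. If `τ` were unbounded there,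
  -- `A` would share the one-point limit set of the convergent path. So `τ` converges, to a positive
  -- value because it increases.
  have key : ∀ (σ : ℝ≥0 → ℝ≥0) (p : ℝ≥0), Continuous σ → (∀ t, σ t ∈ Ioo a b) →
      StrictMono (τ ∘ σ) → Tendsto σ atTop (𝓝 p) → ∃ c, 0 < c ∧ φ p = A c := by
    intro σ p hσ hσab hm hlim
    have heq : A ∘ (τ ∘ σ) = φ ∘ σ := funext fun t => hτ _ (hσab t)
    have hτσ : Continuous (τ ∘ σ) := hcont.comp_continuous hσ hσab
    have hl : Tendsto (φ ∘ σ) atTop (𝓝 (φ p)) := (hφ.continuous.tendsto p).comp hlim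
    rcases limitSet_comp_of_strictMono hA.continuous hτσ hm with h | ⟨c, hc, hc'⟩
    · exfalso
      rw [heq, limitSet_eq_singleton hl] at h
      rw [IsOscillatory, ← h] at hAo
      exact not_nontrivial_singleton hAo
    · rw [heq] at hc'
      exact ⟨c, hc, tendsto_nhds_unique hl hc'⟩
  obtain ⟨⟨σ, hσ, hσm, hσab, hlim⟩, σ', hσ', hσm', hσab', hlim'⟩ := exists_ray_Ioo hab
  rcases hcont.strictMonoOn_of_injOn_Ioo hab hinj with hm | hm
  · obtain ⟨c, hc, hc'⟩ := key σ b hσ hσab (fun s t h => hm (hσab s) (hσab t) (hσm h)) hlim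
    exact ⟨c, hc, Or.inr hc'⟩
  · obtain ⟨c, hc, hc'⟩ := key σ' a hσ' hσab' (fun s t h => hm (hσab' t) (hσab' s) (hσm' h)) hlim'
    exact ⟨c, hc, Or.inl hc'⟩

/-- A ray in a topological graph is not oscillatory. -/
theorem not_isOscillatory_of_graph [T2Space X] {G : Set X} (hG : IsTopologicalGraph G)
    {φ : ℝ≥0 → X} (hφ : IsQuasiArc φ) (m : ℝ≥0) (h : ∀ t, m ≤ t → φ t ∈ G) :
    ¬ IsOscillatory φ := by
  obtain ⟨k, e, he, hun, hdisj⟩ := hG.edges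
  let f : Fin k → unitInterval → X := fun i s => (e i s : X)
  have hf : ∀ i, IsEmbedding (f i) := fun i => IsEmbedding.subtypeVal.comp (he i)
  have hfG : ∀ x ∈ G, ∃ i, x ∈ range (f i) := by
    intro x hx
    have : (⟨x, hx⟩ : G) ∈ ⋃ i, range (e i) := hun ▸ mem_univ _
    obtain ⟨i, s, hs⟩ := mem_iUnion.1 this
    exact ⟨i, s, congrArg Subtype.val hs⟩
  let V : Set X := range (fun i => f i 0) ∪ range (fun i => f i 1)
  have hV : V.Finite := (finite_range _).union (finite_range _)
  have hfd : ∀ i j, i ≠ j → range (f i) ∩ range (f j) ⊆ V := by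
    rintro i j hij _ ⟨⟨s, rfl⟩, ⟨t, ht⟩⟩
    rcases (hdisj i j hij s t (Subtype.ext ht.symm)).1 with rfl | rfl
    · exact Or.inl ⟨i, rfl⟩
    · exact Or.inr ⟨i, rfl⟩
  -- By injectivity the vertices are visited at finitely many times only; from `m'` on,
  -- connectedness confines the ray to a single edge.
  obtain ⟨m', hmm', hm'⟩ : ∃ m', m ≤ m' ∧ ∀ t, m' ≤ t → φ t ∉ V := by
    obtain ⟨B, hB⟩ := (hV.preimage hφ.injective.injOn).bddAbove
    refine ⟨max m (B + 1), le_max_left _ _, fun t ht htV => ?_⟩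
    have h1 : t ≤ B := hB htV
    exact absurd ((le_max_right _ _).trans (ht.trans h1)) (not_le.2 (lt_add_one B))
  obtain ⟨i, hi⟩ := hfG _ (h m' hmm')
  have hpre : IsPreconnected (φ '' Ici m') := isPreconnected_Ici.image _ hφ.continuous.continuousOn
  have hclosed : ∀ j, IsClosed (range (f j)) := fun j =>
    (isCompact_range (hf j).continuous).isClosed
  have hB : IsClosed (⋃ j ∈ {j | j ≠ i}, range (f j)) :=
    (toFinite _).isClosed_biUnion fun j _ => hclosed j
  have hsub : φ '' Ici m' ⊆ range (f i) := by
    have hcov : φ '' Ici m' ⊆ range (f i) ∪ ⋃ j ∈ {j | j ≠ i}, range (f j) := by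
      rintro _ ⟨t, ht, rfl⟩
      obtain ⟨j, hj⟩ := hfG _ (h t (hmm'.trans ht))
      by_cases hji : j = i
      · exact Or.inl (hji ▸ hj)
      · exact Or.inr (mem_iUnion₂.2 ⟨j, hji, hj⟩)
    have hemp : φ '' Ici m' ∩ (range (f i) ∩ ⋃ j ∈ {j | j ≠ i}, range (f j)) = ∅ := by
      rw [eq_empty_iff_forall_notMem]
      rintro _ ⟨⟨t, ht, rfl⟩, h1, h2⟩
      obtain ⟨j, hj, hj'⟩ := mem_iUnion₂.1 h2
      exact hm' t ht (hfd j i hj ⟨hj', h1⟩)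
    rcases isPreconnected_iff_subset_of_disjoint_closed.1 hpre _ _ (hclosed i) hB hcov hemp
      with h1 | h1
    · exact h1
    · obtain ⟨j, hj, hj'⟩ := mem_iUnion₂.1 (h1 ⟨m', self_mem_Ici, rfl⟩)
      exact (hm' m' le_rfl (hfd j i hj ⟨hj', hi⟩)).elim
  intro hosc
  refine not_isOscillatory_of_range_subset_arc (hf i) (ψ := fun t => φ (m' + t))
    ⟨hφ.continuous.comp (by fun_prop), fun s t hst => add_left_cancel (hφ.injective hst)⟩
    (fun t => hsub ⟨m' + t, mem_Ici.2 le_self_add, rfl⟩) ?_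
  rwa [IsOscillatory, limitSet_shift]

end Rays

/-! ### Limit sets in a quasi-graph -/

/-- The part of a quasi-graph composed of the graph and the first `k` quasi-arcs. -/
def stage {X : Type*} (G : Set X) {n : ℕ} (L : Fin n → ℝ≥0 → X) (k : ℕ) : Set X :=
  G ∪ ⋃ j : Fin n, ⋃ (_ : j.val < k), range (L j)

section Stage

variable {X : Type*} {G : Set X} {n : ℕ} {L : Fin n → ℝ≥0 → X}

theorem mem_stage_iff {k : ℕ} {x : X} :
    x ∈ stage G L k ↔ x ∈ G ∨ ∃ j : Fin n, j.val < k ∧ x ∈ range (L j) := by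
  simp only [stage, mem_union, mem_iUnion, exists_prop]

variable [TopologicalSpace X]

theorem isClosed_limitSet_range_subset {C : Set X} (hC : IsClosed C) {φ : ℝ≥0 → X}
    (h : range φ ⊆ C) : limitSet φ ⊆ C :=
  limitSet_subset_closure_range.trans (closure_minimal h hC)

theorem limitSet_subset_omegaSet (i : Fin n) : limitSet (L i) ⊆ omegaSet L :=
  subset_iUnion (fun i => limitSet (L i)) i

theorem isClosed_omegaSet : IsClosed (omegaSet L) :=
  isClosed_iUnion_of_finite fun _ => isClosed_limitSet

theorem IsQuasiGraph.isClosed_graph [T2Space X] (h : IsQuasiGraph G L) : IsClosed G :=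
  (isCompact_iff_compactSpace.2 h.graph.continuum.compact).isClosed

theorem IsQuasiGraph.limitSet_subset_stage (h : IsQuasiGraph G L) (i : Fin n) :
    limitSet (L i) ⊆ stage G L i := by
  intro x hx
  rcases h.limitSet_subset i hx with hG | hj
  · exact mem_stage_iff.2 (Or.inl hG)
  · simp only [mem_iUnion, exists_prop] at hj
    obtain ⟨j, hj, hx⟩ := hj
    exact mem_stage_iff.2 (Or.inr ⟨j, hj, hx⟩)

/-- The closure of `L j` adds only its limit set, which lies in stage `j`. -/
theorem IsQuasiGraph.isClosed_stage [T2Space X] (h : IsQuasiGraph G L) (k : ℕ) :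
    IsClosed (stage G L k) := by
  have := h.continuum.compact
  have heq : stage G L k = G ∪ ⋃ j ∈ {j : Fin n | j.val < k}, closure (range (L j)) := by
    ext x
    simp only [mem_stage_iff, mem_union, mem_iUnion, exists_prop, mem_ofPred_eq]
    constructor
    · rintro (hx | ⟨j, hj, hx⟩)
      · exact Or.inl hx
      · exact Or.inr ⟨j, hj, subset_closure hx⟩
    · rintro (hx | ⟨j, hj, hx⟩)
      · exact Or.inl hx
      · rw [closure_range_eq (h.quasiArc j).continuous] at hx
        rcases hx with hx | hx
        · exact Or.inr ⟨j, hj, hx⟩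
        · rcases mem_stage_iff.1 (h.limitSet_subset_stage j hx) with hx | ⟨l, hl, hx⟩
          · exact Or.inl hx
          · exact Or.inr ⟨l, hl.trans hj, hx⟩
  rw [heq]
  exact h.isClosed_graph.union ((toFinite _).isClosed_biUnion fun _ _ => isClosed_closure)

theorem IsQuasiGraph.notMem_graph (h : IsQuasiGraph G L) {i : Fin n} {t : ℝ≥0} (ht : 0 < t) :
    L i t ∉ G := by
  intro hG
  have h1 : L i t ∈ ({L i 0} : Set X) := h.inter_graph i ▸ ⟨mem_range_self t, hG⟩
  exact ht.ne' ((h.quasiArc i).injective h1)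

theorem IsQuasiGraph.notMem_stage (h : IsQuasiGraph G L) {i : Fin n} {t : ℝ≥0} (ht : 0 < t) :
    L i t ∉ stage G L i := by
  rw [mem_stage_iff]
  rintro (hG | ⟨j, hj, hx⟩)
  · exact h.notMem_graph ht hG
  · exact disjoint_left.1 (h.disjoint j i (Fin.ne_of_lt hj)) hx (mem_range_self t)

/-- If the two sets met, condition 4 would put all of `L i` into its limit set, which condition 3
keeps inside stage `i`; but that stage contains no `L i t` with `t > 0`. -/
theorem IsQuasiGraph.disjoint_limitSet (h : IsQuasiGraph G L) (i : Fin n) :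
    Disjoint (limitSet (L i)) (range (L i)) := by
  rw [Set.disjoint_iff_inter_eq_empty, ← not_nonempty_iff_eq_empty]
  intro hne
  exact h.notMem_stage one_pos
    (h.limitSet_subset_stage i (h.subset_limitSet i i hne (mem_range_self 1)))

theorem IsQuasiGraph.isEmbedding [T2Space X] (h : IsQuasiGraph G L) (i : Fin n) :
    IsEmbedding (L i) :=
  have := h.continuum.compact
  (h.quasiArc i).isEmbedding (h.disjoint_limitSet i)

/-- The limit set of an oscillatory quasi-arc in a quasi-graph is the limit set of one of the
quasi-arcs of the decomposition. -/
theorem IsQuasiGraph.exists_limitSet_eq [T2Space X] (h : IsQuasiGraph G L)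
    {φ : ℝ≥0 → X} (hφ : IsQuasiArc φ)
    (hosc : IsOscillatory φ) : ∃ i, limitSet φ = limitSet (L i) := by
  -- Induction on a stage containing a tail. The tail may stay in the previous stage from some time
  -- on, leave it for good and so run inside one `L i`, or alternate; the last case is impossible.
  have key : ∀ k m, (∀ t, m ≤ t → φ t ∈ stage G L k) → ∃ i, limitSet φ = limitSet (L i) := by
    intro k
    induction k with
    | zero =>
      intro m hm
      refine (not_isOscillatory_of_graph h.graph hφ m (fun t ht => ?_) hosc).elim
      simpa [mem_stage_iff] using hm t ht
    | succ k ih =>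
      intro m hm
      by_cases hA : ∃ m', ∀ t, m' ≤ t → φ t ∈ stage G L k
      · obtain ⟨m', hm'⟩ := hA
        exact ih m' hm'
      push Not at hA
      have hrange : ∀ t, m ≤ t → φ t ∉ stage G L k →
          ∃ j : Fin n, j.val = k ∧ φ t ∈ range (L j) := by
        intro t ht hkt
        rcases mem_stage_iff.1 (hm t ht) with hG | ⟨j, hj, hx⟩
        · exact (hkt (mem_stage_iff.2 (Or.inl hG))).elim
        · refine ⟨j, ?_, hx⟩
          by_contra hne
          exact hkt (mem_stage_iff.2 (Or.inr ⟨j, by omega, hx⟩))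
      obtain ⟨t₁, ht₁, hkt₁⟩ := hA (m + 1)
      have hmt₁ : m ≤ t₁ := le_self_add.trans ht₁
      obtain ⟨i, hik, -⟩ := hrange t₁ hmt₁ hkt₁
      have hri : ∀ t, m ≤ t → φ t ∉ stage G L k → φ t ∈ range (L i) := by
        intro t ht hkt
        obtain ⟨j, hjk, hj⟩ := hrange t ht hkt
        rwa [show i = j from Fin.ext (hik.trans hjk.symm)]
      by_cases hB : ∃ m', m ≤ m' ∧ ∀ t, m' ≤ t → φ t ∉ stage G L k
      · obtain ⟨m', hmm', hm'⟩ := hB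
        refine ⟨i, ?_⟩
        rw [← limitSet_shift φ m']
        refine limitSet_eq_of_range_subset (h.isEmbedding i)
          ⟨hφ.continuous.comp (by fun_prop), fun s t hst => add_left_cancel (hφ.injective hst)⟩
          (fun t => hri _ (hmm'.trans le_self_add) (hm' _ le_self_add)) ?_
        rwa [IsOscillatory, limitSet_shift]
      push Not at hB
      -- An alternating ray makes an excursion `(a, b)` into `L i` with both ends in the previous
      -- stage. By `exists_endpoint_mem_image` one of the ends is `L i c` with `c > 0`, which is
      -- outside that stage.
      exfalso
      obtain ⟨t₀, hmt₀, hkt₀⟩ := hB m le_rfl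
      obtain ⟨t₂, ht₂, hkt₂⟩ := hB t₁ hmt₁
      obtain ⟨t₃, ht₃, hkt₃⟩ := hA t₀
      obtain ⟨t₄, ht₄, hkt₄⟩ := hB t₃ (hmt₀.trans ht₃)
      have hS : IsClosed (φ ⁻¹' stage G L k) := (h.isClosed_stage k).preimage hφ.continuous
      obtain ⟨a, ⟨⟨hat₀, hat₃⟩, hak⟩, ha⟩ := (isCompact_Icc.inter_right hS).exists_isGreatest
        ⟨t₀, ⟨le_rfl, ht₃⟩, hkt₀⟩
      obtain ⟨b, ⟨⟨hbt₃, hbt₄⟩, hbk⟩, hb⟩ := (isCompact_Icc.inter_right hS).exists_isLeast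
        ⟨t₄, ⟨ht₄, le_rfl⟩, hkt₄⟩
      have hat : a < t₃ := lt_of_le_of_ne hat₃ fun h => hkt₃ (h ▸ hak)
      have hIoo : ∀ t ∈ Ioo a b, φ t ∈ range (L i) := by
        intro t ht
        refine hri t (hmt₀.trans (hat₀.trans ht.1.le)) fun hk => ?_
        rcases le_total t t₃ with htt | htt
        · exact absurd (ha ⟨⟨hat₀.trans ht.1.le, htt⟩, hk⟩) (not_le.2 ht.1)
        · exact absurd (hb ⟨⟨htt, ht.2.le.trans hbt₄⟩, hk⟩) (not_le.2 ht.2)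
      obtain ⟨c, hc, hc' | hc'⟩ := exists_endpoint_mem_image (h.isEmbedding i) (h.oscillatory i) hφ
        (hat.trans_le hbt₃) hIoo
      · have : L i c ∈ stage G L k := by rw [← hc']; exact hak
        rw [← hik] at this
        exact h.notMem_stage hc this
      · have : L i c ∈ stage G L k := by rw [← hc']; exact hbk
        rw [← hik] at this
        exact h.notMem_stage hc this
  refine key n 0 fun t _ => ?_
  have : φ t ∈ G ∪ ⋃ i, range (L i) := h.union_eq ▸ mem_univ _
  rcases this with hG | hj
  · exact mem_stage_iff.2 (Or.inl hG)
  · obtain ⟨j, hj⟩ := mem_iUnion.1 hj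
    exact mem_stage_iff.2 (Or.inr ⟨j, j.2, hj⟩)

theorem IsQuasiGraph.range_subset_or_disjoint (h : IsQuasiGraph G L) (i : Fin n) :
    range (L i) ⊆ omegaSet L ∨ Disjoint (range (L i)) (omegaSet L) := by
  by_cases hd : Disjoint (range (L i)) (omegaSet L)
  · exact Or.inr hd
  · obtain ⟨x, hx, hxo⟩ := not_disjoint_iff.1 hd
    obtain ⟨j, hj⟩ := mem_iUnion.1 hxo
    exact Or.inl ((h.subset_limitSet j i ⟨x, hj, hx⟩).trans (limitSet_subset_omegaSet j))

/-- A limit set that meets `Λ` lies in `Λ`; in particular `φ` is oscillatory. If `L i` met `omegaSet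
L`, it would lie in some `limitSet (L j)`, which meets `Λ` and so lies in `Λ = limitSet (L i)`,
against `disjoint_limitSet`. -/
theorem IsQuasiGraph.exists_limitSet_eq_component [T2Space X] (h : IsQuasiGraph G L) {Λ : Set X}
    (hΛ : Λ ∈ componentsOf (omegaSet L))
    (hφ : ∃ φ : ℝ≥0 → X, IsQuasiArc φ ∧ limitSet φ = Λ) :
    ∃ i, limitSet (L i) = Λ ∧ Disjoint (range (L i)) (omegaSet L) := by
  have := h.continuum.compact
  obtain ⟨φ, hφ, rfl⟩ := hφ
  have hsub : ∀ j, ∀ x ∈ limitSet (L j), x ∈ limitSet φ → limitSet (L j) ⊆ limitSet φ :=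
    fun j x hx hx' => subset_of_isPreconnected hΛ
      (isConnected_limitSet (h.quasiArc j).continuous).isPreconnected (limitSet_subset_omegaSet j)
      hx' hx
  have hosc : IsOscillatory φ := by
    obtain ⟨x, hx⟩ := limitSet_nonempty (φ := φ)
    obtain ⟨j, hj⟩ := mem_iUnion.1 (subset_of_mem_componentsOf hΛ hx)
    exact (h.oscillatory j).mono (hsub j x hj hx)
  obtain ⟨i, hi⟩ := h.exists_limitSet_eq hφ hosc
  refine ⟨i, hi.symm, ?_⟩
  rw [disjoint_left]
  rintro x hx hxo
  obtain ⟨j, hj⟩ := mem_iUnion.1 hxo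
  have h1 := h.subset_limitSet j i ⟨x, hj, hx⟩
  obtain ⟨y, hy⟩ := limitSet_nonempty (φ := L i)
  have h2 := hsub j y (isClosed_limitSet_range_subset isClosed_limitSet h1 hy) (hi ▸ hy)
  rw [hi] at h2
  exact disjoint_left.1 (h.disjoint_limitSet i) (h2 (h1 hx)) hx

theorem IsQuasiGraph.finite_componentsOf [T2Space X] (h : IsQuasiGraph G L) :
    (componentsOf (omegaSet L)).Finite := by
  have := h.continuum.compact
  choose p hp using fun i => limitSet_nonempty (φ := L i)
  refine (finite_range fun i => connectedComponentIn (omegaSet L) (p i)).subset ?_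
  rintro Λ hΛ
  obtain ⟨x, hx⟩ := (isConnected_of_mem_componentsOf hΛ).nonempty
  obtain ⟨i, hi⟩ := mem_iUnion.1 (subset_of_mem_componentsOf hΛ hx)
  have h1 := subset_of_isPreconnected hΛ
    (isConnected_limitSet (h.quasiArc i).continuous).isPreconnected (limitSet_subset_omegaSet i)
    hx hi
  have hc := mem_component (W := omegaSet L) (mem_iUnion.2 ⟨i, hp i⟩)
  exact ⟨i, eq_of_mem_componentsOf hc.1 hΛ hc.2 (h1 (hp i))⟩

end Stage

/-! ### Finiteness of the traces of limit sets on the graph -/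

/-- `E` is covered, as far as its relatively clopen subsets can tell, by finitely many
components: a finite set meets all its nonempty relatively clopen subsets. -/
def HasFiniteClopenTransversal {X : Type*} [TopologicalSpace X] (E : Set X) : Prop :=
  ∃ D : Set X, D.Finite ∧ ∀ P, P.Nonempty → P ⊆ E → IsClosed P → IsClosed (E \ P) → (P ∩ D).Nonempty

section Transversal

variable {X : Type*} [TopologicalSpace X]

theorem HasFiniteClopenTransversal.iUnion {ι : Type*} [Finite ι] {E : ι → Set X}
    (hE : ∀ i, HasFiniteClopenTransversal (E i)) (hcl : ∀ i, IsClosed (E i)) :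
    HasFiniteClopenTransversal (⋃ i, E i) := by
  choose D hD hmeet using hE
  refine ⟨⋃ i, D i, finite_iUnion hD, fun P ⟨x, hx⟩ hPE hP hP' => ?_⟩
  obtain ⟨i, hi⟩ := mem_iUnion.1 (hPE hx)
  obtain ⟨y, hy, hyD⟩ := hmeet i (P ∩ E i) ⟨x, hx, hi⟩ inter_subset_right (hP.inter (hcl i)) (by
    have : E i \ (P ∩ E i) = ((⋃ i, E i) \ P) ∩ E i := by
      ext z
      constructor
      · rintro ⟨hz, hz'⟩
        exact ⟨⟨mem_iUnion.2 ⟨i, hz⟩, fun h => hz' ⟨h, hz⟩⟩, hz⟩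
      · rintro ⟨⟨-, hz'⟩, hz⟩
        exact ⟨hz, fun h => hz' h.1⟩
    rw [this]
    exact hP'.inter (hcl i))
  exact ⟨y, hy.1, mem_iUnion.2 ⟨i, hyD⟩⟩

theorem HasFiniteClopenTransversal.of_subset {T B : Set X} (hT : HasFiniteClopenTransversal T)
    (hTcl : IsClosed T) (hTB : T ⊆ B)
    (h : ∀ P, P.Nonempty → P ⊆ B → IsClosed P → IsClosed (B \ P) → (P ∩ T).Nonempty) :
    HasFiniteClopenTransversal B := by
  obtain ⟨D, hD, hmeet⟩ := hT
  refine ⟨D, hD, fun P hne hPB hP hP' => ?_⟩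
  obtain ⟨y, hy, hyD⟩ := hmeet (P ∩ T) (h P hne hPB hP hP') inter_subset_right (hP.inter hTcl) (by
    have : T \ (P ∩ T) = (B \ P) ∩ T := by
      ext z
      constructor
      · rintro ⟨hz, hz'⟩
        exact ⟨⟨hTB hz, fun h => hz' ⟨h, hz⟩⟩, hz⟩
      · rintro ⟨⟨-, hz'⟩, hz⟩
        exact ⟨hz, fun h => hz' h.1⟩
    rw [this]
    exact hP'.inter hTcl)
  exact ⟨y, hy.1, hyD⟩

theorem hasFiniteClopenTransversal_of_isPreconnected {E : Set X} (hE : IsPreconnected E) :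
    HasFiniteClopenTransversal E := by
  rcases E.eq_empty_or_nonempty with rfl | ⟨x, hx⟩
  · exact ⟨∅, finite_empty, fun P hne hP => (hne.ne_empty (subset_empty_iff.1 hP)).elim⟩
  · refine ⟨{x}, finite_singleton x, fun P hne hPE hP hP' => ?_⟩
    have hcov : E ⊆ P ∪ E \ P := fun y hy => by by_cases h : y ∈ P <;> simp [h, hy]
    have hemp : E ∩ (P ∩ (E \ P)) = ∅ := by
      rw [inter_sdiff_self, inter_empty]
    rcases isPreconnected_iff_subset_of_disjoint_closed.1 hE P (E \ P) hP hP' hcov hemp with h | h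
    · exact ⟨x, h hx, rfl⟩
    · obtain ⟨y, hy⟩ := hne
      exact ((h (hPE hy)).2 hy).elim

/-- The limit sets of a quasi-graph meet the graph in finitely many pieces. -/
theorem IsQuasiGraph.hasFiniteClopenTransversal_limitSet [T2Space X] {G : Set X} {n : ℕ}
    {L : Fin n → ℝ≥0 → X} (h : IsQuasiGraph G L) (i : Fin n) :
    HasFiniteClopenTransversal (limitSet (L i) ∩ G) := by
  have := h.continuum.compact
  have hG := h.isClosed_graph
  induction i using WellFoundedLT.induction with
  | ind i ih =>
  let J : Type := {j : Fin n // j < i ∧ range (L j) ⊆ limitSet (L i)}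
  have hJ : limitSet (L i) ⊆ (limitSet (L i) ∩ G) ∪ ⋃ j : J, range (L j) := by
    intro x hx
    rcases h.limitSet_subset i hx with hxG | hxj
    · exact Or.inl ⟨hx, hxG⟩
    · simp only [mem_iUnion, exists_prop] at hxj
      obtain ⟨j, hj, hxj⟩ := hxj
      exact Or.inr (mem_iUnion.2 ⟨⟨j, hj, h.subset_limitSet i j ⟨x, hx, hxj⟩⟩, hxj⟩)
  rcases isEmpty_or_nonempty J with hemp | ⟨⟨j₀⟩⟩
  · have : limitSet (L i) ∩ G = limitSet (L i) :=
      subset_antisymm inter_subset_left fun x hx => by simpa using hJ hx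
    rw [this]
    exact hasFiniteClopenTransversal_of_isPreconnected
      (isConnected_limitSet (h.quasiArc i).continuous).isPreconnected
  -- The closures of the quasi-arcs in `limitSet (L i)` touch `G` only here: at their endpoints and
  -- in the traces of their limit sets, which are handled by induction.
  let T : Set X := ⋃ j : J, ⋃ b : Bool, if b then {L j 0} else limitSet (L j) ∩ G
  have hcl : ∀ (j : J) (b : Bool), IsClosed (if b then {L j 0} else limitSet (L j) ∩ G) := by
    intro j b
    cases b
    · simpa using isClosed_limitSet.inter hG
    · simp
  have hTcl : IsClosed T :=
    isClosed_iUnion_of_finite fun j => isClosed_iUnion_of_finite fun b => hcl j b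
  have hT : HasFiniteClopenTransversal T := by
    refine .iUnion (fun j => .iUnion (fun b => ?_) fun b => hcl j b)
      fun j => isClosed_iUnion_of_finite fun b => hcl j b
    cases b
    · simpa using ih j.1 j.2.1
    · simpa using hasFiniteClopenTransversal_of_isPreconnected isPreconnected_singleton
  have hL0 : ∀ j, L j 0 ∈ G := fun j => by
    have : L j 0 ∈ range (L j) ∩ G := by rw [h.inter_graph j]; rfl
    exact this.2
  have hlim : ∀ j : J, limitSet (L j) ⊆ limitSet (L i) := fun j =>
    isClosed_limitSet_range_subset isClosed_limitSet j.2.2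
  have hT0 : ∀ j : J, L j 0 ∈ T := fun j => mem_iUnion₂.2 ⟨j, true, by simp⟩
  have hTlim : ∀ j : J, limitSet (L j) ∩ G ⊆ T := fun j x hx => mem_iUnion₂.2 ⟨j, false, by simpa⟩
  have hTB : T ⊆ limitSet (L i) ∩ G := by
    intro x hx
    obtain ⟨j, b, hx⟩ := mem_iUnion₂.1 hx
    cases b
    · have hx : x ∈ limitSet (L j) ∩ G := by simpa using hx
      exact ⟨hlim j hx.1, hx.2⟩
    · have hx : x = L j 0 := by simpa using hx
      rw [hx]
      exact ⟨j.2.2 (mem_range_self 0), hL0 _⟩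
  refine hT.of_subset hTcl hTB fun P hne hPB hP hP' => ?_
  by_contra hPT
  rw [not_nonempty_iff_eq_empty, ← Set.disjoint_iff_inter_eq_empty, disjoint_left] at hPT
  -- If `P` avoids `T`, it is disjoint from the closed set `C`, so `P` is relatively clopen in the
  -- connected set `limitSet (L i)`. But it is nonempty and omits `L j₀ 0`.
  let C : Set X := ((limitSet (L i) ∩ G) \ P) ∪ ⋃ j : J, closure (range (L j))
  have hC : IsClosed C := hP'.union (isClosed_iUnion_of_finite fun j => isClosed_closure)
  have hPC : ∀ x ∈ P, x ∉ C := by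
    rintro x hx (hxC | hxC)
    · exact hxC.2 hx
    · obtain ⟨j, hj⟩ := mem_iUnion.1 hxC
      rw [closure_range_eq (h.quasiArc j).continuous] at hj
      rcases hj with hj | hj
      · have : x ∈ ({L j 0} : Set X) := h.inter_graph j ▸ ⟨hj, (hPB hx).2⟩
        exact hPT hx (mem_singleton_iff.1 this ▸ hT0 j)
      · exact hPT hx (hTlim j ⟨hj, (hPB hx).2⟩)
  have hcov : limitSet (L i) ⊆ P ∪ C := by
    intro x hx
    by_cases hxP : x ∈ P
    · exact Or.inl hxP
    · rcases hJ hx with h1 | h1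
      · exact Or.inr (Or.inl ⟨h1, hxP⟩)
      · obtain ⟨j, hj⟩ := mem_iUnion.1 h1
        exact Or.inr (Or.inr (mem_iUnion.2 ⟨j, subset_closure hj⟩))
  have hemp : limitSet (L i) ∩ (P ∩ C) = ∅ := by
    rw [eq_empty_iff_forall_notMem]
    rintro x ⟨-, hxP, hxC⟩
    exact hPC x hxP hxC
  rcases isPreconnected_iff_subset_of_disjoint_closed.1
    (isConnected_limitSet (h.quasiArc i).continuous).isPreconnected P C hP hC hcov hemp with h1 | h1
  · exact hPT (h1 (j₀.2.2 (mem_range_self 0))) (hT0 j₀)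
  · obtain ⟨x, hx⟩ := hne
    exact hPC x hx (h1 (hPB hx).1)

theorem IsQuasiGraph.hasFiniteClopenTransversal_omegaSet [T2Space X] {G : Set X} {n : ℕ}
    {L : Fin n → ℝ≥0 → X} (h : IsQuasiGraph G L) :
    HasFiniteClopenTransversal (omegaSet L ∩ G) := by
  rw [omegaSet, iUnion_inter]
  exact .iUnion h.hasFiniteClopenTransversal_limitSet fun i =>
    isClosed_limitSet.inter h.isClosed_graph

end Transversal

/-! ### Decomposition into open arcs -/

theorem exists_isOpenEmbedding_range_eq {C : Set ℝ} (hO : IsOpen C) (hc : IsConnected C)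
    (hb : BddBelow C) (ha : BddAbove C) : ∃ η : ℝ → ℝ, IsOpenEmbedding η ∧ range η = C := by
  have hC : C = Ioo (sInf C) (sSup C) := by
    refine subset_antisymm ?_ (hc.Ioo_csInf_csSup_subset hb ha)
    rw [← interior_Icc]
    exact interior_maximal (subset_Icc_csInf_csSup hb ha) hO
  have hlt : sInf C < sSup C := by
    obtain ⟨x, hx⟩ := hc.nonempty
    rw [hC] at hx
    exact hx.1.trans hx.2
  let e := OpenPartialHomeomorph.univBall (E := ℝ) ((sInf C + sSup C) / 2) ((sSup C - sInf C) / 2)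
  refine ⟨e, e.isOpenEmbedding (OpenPartialHomeomorph.univBall_source _ _), ?_⟩
  rw [← image_univ, ← show e.source = univ from OpenPartialHomeomorph.univBall_source _ _,
    e.image_source_eq_target,
    show e.target = _ from OpenPartialHomeomorph.univBall_target _ (by linarith),
    ← Real.Ioo_eq_ball]
  exact hC.symm

theorem exists_isEmbedding_range_eq_Ioi :
    ∃ η : ℝ → ℝ≥0, IsEmbedding η ∧ range η = Ioi 0 := by
  refine ⟨fun t => (Real.exp t).toNNReal, ?_, ?_⟩
  · have h1 : IsEmbedding (((↑) : ℝ≥0 → ℝ) ∘ fun t => (Real.exp t).toNNReal) := by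
      have : (((↑) : ℝ≥0 → ℝ) ∘ fun t => (Real.exp t).toNNReal) = Real.exp :=
        funext fun t => Real.coe_toNNReal _ (Real.exp_pos t).le
      rw [this]
      exact Real.isOpenEmbedding_exp.isEmbedding
    exact .of_comp (continuous_real_toNNReal.comp Real.continuous_exp) NNReal.continuous_coe h1
  · ext t
    constructor
    · rintro ⟨s, rfl⟩
      exact Real.toNNReal_pos.2 (Real.exp_pos s)
    · intro ht
      exact ⟨Real.log t, by
        show (Real.exp (Real.log t)).toNNReal = t
        rw [Real.exp_log (NNReal.coe_pos.2 ht), Real.toNNReal_coe]⟩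

section Edges

variable {X : Type*} [TopologicalSpace X] {G : Set X}

/-- The edges of a graph in `X`, parametrized by `[0,1]`. -/
structure IsEdgeSystem (G : Set X) {k : ℕ} (F : Fin k → ℝ → X) : Prop where
  continuous : ∀ i, Continuous (F i)
  injOn : ∀ i, InjOn (F i) (Icc 0 1)
  iUnion_eq : ⋃ i, F i '' Icc 0 1 = G
  ne : ∀ i j, i ≠ j → ∀ s ∈ Ioo (0 : ℝ) 1, ∀ t ∈ Icc (0 : ℝ) 1, F i s ≠ F j t

theorem IsTopologicalGraph.exists_isEdgeSystem (hG : IsTopologicalGraph G) :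
    ∃ (k : ℕ) (F : Fin k → ℝ → X), IsEdgeSystem G F := by
  obtain ⟨k, e, he, hun, hdisj⟩ := hG.edges
  have hproj : ∀ s (hs : s ∈ Icc (0 : ℝ) 1), projIcc (0 : ℝ) 1 zero_le_one s = ⟨s, hs⟩ :=
    fun s hs => projIcc_of_mem _ hs
  refine ⟨k, fun i s => (e i (projIcc 0 1 zero_le_one s) : X), fun i =>
    continuous_subtype_val.comp ((he i).continuous.comp continuous_projIcc), ?_, ?_, ?_⟩
  · intro i s hs t ht hst
    simp only [hproj s hs, hproj t ht] at hst
    exact congrArg Subtype.val ((he i).injective (Subtype.ext hst))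
  · ext x
    simp only [mem_iUnion, mem_image]
    constructor
    · rintro ⟨i, s, -, rfl⟩
      exact Subtype.coe_prop _
    · intro hx
      have : (⟨x, hx⟩ : G) ∈ ⋃ i, range (e i) := hun ▸ mem_univ _
      obtain ⟨i, s, hs⟩ := mem_iUnion.1 this
      exact ⟨i, s, s.2, by rw [hproj s s.2, Subtype.coe_eta, hs]⟩
  · intro i j hij s hs t ht hst
    have hs' := Ioo_subset_Icc_self hs
    simp only [hproj s hs', hproj t ht] at hst
    rcases (hdisj i j hij _ _ (Subtype.ext hst)).1 with h | h
    · exact hs.1.ne' (congrArg Subtype.val h)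
    · exact hs.2.ne (congrArg Subtype.val h)

variable {k : ℕ} {F : Fin k → ℝ → X}

theorem IsEdgeSystem.isEmbedding_comp [T2Space X] (hF : IsEdgeSystem G F) (i : Fin k)
    {η : ℝ → ℝ} (hη : IsEmbedding η) (hr : range η ⊆ Icc 0 1) : IsEmbedding (F i ∘ η) := by
  have h1 : IsEmbedding ((Icc (0 : ℝ) 1).domRestrict (F i)) :=
    ((hF.continuous i).continuousOn.domRestrict.isClosedEmbedding
      (hF.injOn i).injective).isEmbedding
  have h2 : IsEmbedding (fun t => (⟨η t, hr (mem_range_self t)⟩ : Icc (0 : ℝ) 1)) :=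
    .of_comp (hη.continuous.subtype_mk _) continuous_subtype_val hη
  exact h1.comp h2

/-- An interval in the interior of an edge is separated from the rest of the graph. -/
theorem IsEdgeSystem.sdiff_image (hF : IsEdgeSystem G F) (i : Fin k) {C : Set ℝ}
    (hC : C ⊆ Ioo 0 1) :
    G \ F i '' C = F i '' (Icc 0 1 \ C) ∪ ⋃ j ∈ {j | j ≠ i}, F j '' Icc 0 1 := by
  rw [← hF.iUnion_eq]
  ext x
  simp only [Set.mem_sdiff, mem_iUnion, mem_union, mem_image, mem_ofPred_eq, exists_prop]
  constructor
  · rintro ⟨⟨j, t, ht, rfl⟩, hx⟩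
    by_cases hji : j = i
    · subst hji
      exact Or.inl ⟨t, ⟨ht, fun htC => hx ⟨t, htC, rfl⟩⟩, rfl⟩
    · exact Or.inr ⟨j, hji, t, ht, rfl⟩
  · rintro (⟨t, ⟨ht, htC⟩, rfl⟩ | ⟨j, hji, t, ht, rfl⟩)
    · refine ⟨⟨i, t, ht, rfl⟩, ?_⟩
      rintro ⟨s, hs, hst⟩
      exact htC (hF.injOn i (Ioo_subset_Icc_self (hC hs)) ht hst ▸ hs)
    · refine ⟨⟨j, t, ht, rfl⟩, ?_⟩
      rintro ⟨s, hs, hst⟩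
      exact hF.ne i j (Ne.symm hji) s (hC hs) t ht hst

theorem IsEdgeSystem.isClosed_sdiff_image [T2Space X] (hF : IsEdgeSystem G F) (i : Fin k)
    {C : Set ℝ} (hC : C ⊆ Ioo 0 1) (hO : IsOpen C) : IsClosed (G \ F i '' C) := by
  rw [hF.sdiff_image i hC]
  exact ((isCompact_Icc.diff hO).image (hF.continuous i)).isClosed.union
    ((toFinite _).isClosed_biUnion fun j _ => (isCompact_Icc.image (hF.continuous j)).isClosed)

/-- The complement in an edge of a set with a finite clopen transversal has finitely many
components. -/
theorem IsEdgeSystem.finite_componentsOf [T2Space X] (hF : IsEdgeSystem G F) {E : Set X}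
    (hEG : E ⊆ G) (hEcl : IsClosed E) (hE : HasFiniteClopenTransversal E) (i : Fin k) :
    (componentsOf {s | s ∈ Ioo (0 : ℝ) 1 ∧ F i s ∉ E}).Finite := by
  obtain ⟨D, hD, hmeet⟩ := hE
  set U : Set ℝ := {s | s ∈ Ioo (0 : ℝ) 1 ∧ F i s ∉ E} with hU
  let D' : Set ℝ := Icc 0 1 ∩ F i ⁻¹' D
  have hD' : D'.Finite := 
    .of_finite_image (f := F i) (hD.subset (image_subset_iff.2 inter_subset_right))
      ((hF.injOn i).mono inter_subset_left)
  have hp : ∀ C : Set ℝ, ∃ p, C ∈ componentsOf U → p ∈ C := by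
    intro C
    by_cases hC : C ∈ componentsOf U
    · obtain ⟨p, hp⟩ := (isConnected_of_mem_componentsOf hC).nonempty
      exact ⟨p, fun _ => hp⟩
    · exact ⟨0, fun h => (hC h).elim⟩
  choose p hp using hp
  -- Some part of `E` separates two components on the edge. It is relatively clopen in `E`, so it
  -- contains a point of the transversal. Hence a component is determined by the set of transversal
  -- parameters to its left.
  have key : ∀ C ∈ componentsOf U, ∀ C' ∈ componentsOf U, p C < p C' →
      D' ∩ Iio (p C) ≠ D' ∩ Iio (p C') := by
    intro C hC C' hC' hlt heq
    have hpU := subset_of_mem_componentsOf hC (hp C hC)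
    have hpU' := subset_of_mem_componentsOf hC' (hp C' hC')
    have hI : Ioo (p C) (p C') ⊆ Ioo 0 1 := Ioo_subset_Ioo hpU.1.1.le hpU'.1.2.le
    have hIcc : Icc (p C) (p C') ⊆ Ioo 0 1 := fun x hx =>
      ⟨hpU.1.1.trans_le hx.1, hx.2.trans_lt hpU'.1.2⟩
    have hnot : ∃ y, y ∈ E ∩ F i '' Ioo (p C) (p C') := by
      by_contra! hcon
      have hsub : Icc (p C) (p C') ⊆ U := by
        intro x hx
        refine ⟨hIcc hx, fun hxE => ?_⟩
        rcases eq_or_ne x (p C) with rfl | h1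
        · exact hpU.2 hxE
        rcases eq_or_ne x (p C') with rfl | h2
        · exact hpU'.2 hxE
        exact hcon _ ⟨hxE, x, ⟨lt_of_le_of_ne hx.1 h1.symm, lt_of_le_of_ne hx.2 h2⟩, rfl⟩
      have h1 := subset_of_isPreconnected hC isPreconnected_Icc hsub (hp C hC)
        (left_mem_Icc.2 hlt.le)
      have h2 := eq_of_mem_componentsOf hC hC' (h1 (right_mem_Icc.2 hlt.le)) (hp C' hC')
      rw [h2] at hlt
      exact lt_irrefl _ hlt
    -- The end parameters are not in `E`, so the open and the closed interval cut out the same part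
    -- of `E`; this makes it relatively clopen.
    have hPeq : E ∩ F i '' Ioo (p C) (p C') = E ∩ F i '' Icc (p C) (p C') := by
      refine subset_antisymm (inter_subset_inter_right _ (image_mono Ioo_subset_Icc_self)) ?_
      rintro _ ⟨hxE, x, hx, rfl⟩
      refine ⟨hxE, x, ⟨lt_of_le_of_ne hx.1 ?_, lt_of_le_of_ne hx.2 ?_⟩, rfl⟩
      · rintro rfl
        exact hpU.2 hxE
      · rintro rfl
        exact hpU'.2 hxE
    obtain ⟨_, ⟨-, t, ht, rfl⟩, htD⟩ := hmeet (E ∩ F i '' Ioo (p C) (p C')) hnot inter_subset_left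
      (by
        rw [hPeq]
        exact hEcl.inter (isCompact_Icc.image (hF.continuous i)).isClosed)
      (by
        have : E \ (E ∩ F i '' Ioo (p C) (p C')) = E ∩ (G \ F i '' Ioo (p C) (p C')) := by
          ext x
          constructor
          · rintro ⟨h1, h2⟩
            exact ⟨h1, hEG h1, fun h => h2 ⟨h1, h⟩⟩
          · rintro ⟨h1, -, h2⟩
            exact ⟨h1, fun h => h2 h.2⟩
        rw [this]
        exact hEcl.inter (hF.isClosed_sdiff_image i hI isOpen_Ioo))
    have h1 : t ∈ D' ∩ Iio (p C') := ⟨⟨Ioo_subset_Icc_self (hI ht), htD⟩, ht.2⟩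
    rw [← heq] at h1
    exact lt_asymm ht.1 h1.2
  refine Finite.of_finite_image (f := fun C => D' ∩ Iio (p C))
    (hD'.finite_subsets.subset ?_) ?_
  · rintro _ ⟨C, -, rfl⟩
    exact inter_subset_left
  · intro C hC C' hC' heq
    rcases lt_trichotomy (p C) (p C') with h | h | h
    · exact (key C hC C' hC' h heq).elim
    · exact eq_of_mem_componentsOf hC hC' (hp C hC) (h ▸ hp C' hC')
    · exact (key C' hC' C hC h heq.symm).elim

end Edges

theorem HasFiniteClopenTransversal.union {X : Type*} [TopologicalSpace X] {E E' : Set X}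
    (hE : HasFiniteClopenTransversal E) (hE' : HasFiniteClopenTransversal E') (hcl : IsClosed E)
    (hcl' : IsClosed E') : HasFiniteClopenTransversal (E ∪ E') := by
  rw [union_eq_iUnion]
  refine .iUnion (fun b => ?_) fun b => ?_
  · cases b
    exacts [hE', hE]
  · cases b
    exacts [hcl', hcl]

/-- Off its limit sets and a finite set, a quasi-graph is a finite disjoint union of open arcs. -/
theorem IsQuasiGraph.exists_openArcs {X : Type*} [TopologicalSpace X] [T2Space X] {G : Set X}
    {n : ℕ} {L : Fin n → ℝ≥0 → X} (h : IsQuasiGraph G L) :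
    ∃ (ι : Type) (_ : Finite ι) (g : ι → ℝ → X), (∀ a, IsOpenEmbedding (g a)) ∧
      (∀ a b, a ≠ b → Disjoint (range (g a)) (range (g b))) ∧
      (∀ a, Disjoint (range (g a)) (omegaSet L)) ∧
      ((⋃ a, range (g a)) ∪ omegaSet L)ᶜ.Finite := by
  have := h.continuum.compact
  obtain ⟨k, F, hF⟩ := h.graph.exists_isEdgeSystem
  let A : Set X := range fun j => L j 0
  have hA : A.Finite := finite_range _
  have hL0 : ∀ j, L j 0 ∈ G := fun j => by
    have : L j 0 ∈ range (L j) ∩ G := by rw [h.inter_graph j]; rfl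
    exact this.2
  -- Endpoints of quasi-arcs are removed too, since a piece of an edge containing one is not open in
  -- `X`.
  let E : Set X := (omegaSet L ∩ G) ∪ A
  have hEG : E ⊆ G := union_subset inter_subset_right (range_subset_iff.2 hL0)
  have hωcl : IsClosed (omegaSet L ∩ G) := isClosed_omegaSet.inter h.isClosed_graph
  have hEcl : IsClosed E := hωcl.union hA.isClosed
  have hE : HasFiniteClopenTransversal E := by
    refine h.hasFiniteClopenTransversal_omegaSet.union ⟨A, hA, fun P hne hPA _ _ => ?_⟩ hωcl
      hA.isClosed
    rwa [inter_eq_left.2 hPA]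
  let U : Fin k → Set ℝ := fun i => {s | s ∈ Ioo (0 : ℝ) 1 ∧ F i s ∉ E}
  have hUo : ∀ i, IsOpen (U i) := fun i =>
    isOpen_Ioo.inter (hEcl.isOpen_compl.preimage (hF.continuous i))
  have hcomp : ∀ i, ∀ C ∈ componentsOf (U i), ∃ η : ℝ → ℝ, IsOpenEmbedding η ∧ range η = C := by
    intro i C hC
    have hsub : C ⊆ Icc 0 1 := fun x hx =>
      Ioo_subset_Icc_self (subset_of_mem_componentsOf hC hx).1
    refine exists_isOpenEmbedding_range_eq ?_ (isConnected_of_mem_componentsOf hC)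
      (bddBelow_Icc.mono hsub) (bddAbove_Icc.mono hsub)
    obtain ⟨x, -, rfl⟩ := hC
    exact (hUo i).connectedComponentIn
  choose! η hη hηr using hcomp
  obtain ⟨ζ, hζ, hζr⟩ := exists_isEmbedding_range_eq_Ioi
  -- The open arcs are of two kinds: quasi-arcs off the limit sets, without their endpoints, and
  -- components of open edges minus `E`.
  let ι₁ : Type := {j : Fin n // Disjoint (range (L j)) (omegaSet L)}
  let ι₂ : Type := Σ i : Fin k, componentsOf (U i)
  have : ∀ i, Finite (componentsOf (U i)) := fun i => hF.finite_componentsOf hEG hEcl hE i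
  let g : ι₁ ⊕ ι₂ → ℝ → X := Sum.elim (fun j => L j ∘ ζ) (fun p => F p.1 ∘ η p.1 p.2)
  have hr₁ : ∀ j : ι₁, range (g (Sum.inl j)) = L j '' Ioi 0 := fun j => by
    show range (L j ∘ ζ) = _
    rw [range_comp, hζr]
  have hr₂ : ∀ p : ι₂, range (g (Sum.inr p)) = F p.1 '' p.2 := fun p => by
    show range (F p.1 ∘ η p.1 p.2) = _
    rw [range_comp, hηr _ _ p.2.2]
  have hpU : ∀ p : ι₂, (p.2 : Set ℝ) ⊆ U p.1 := fun p => subset_of_mem_componentsOf p.2.2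
  have hpI : ∀ p : ι₂, (p.2 : Set ℝ) ⊆ Ioo 0 1 := fun p x hx => (hpU p hx).1
  have hFG : ∀ i, ∀ s ∈ Icc (0 : ℝ) 1, F i s ∈ G := fun i s hs => by
    rw [← hF.iUnion_eq]
    exact mem_iUnion.2 ⟨i, s, hs, rfl⟩
  have hpG : ∀ p : ι₂, F p.1 '' p.2 ⊆ G := by
    rintro p _ ⟨s, hs, rfl⟩
    exact hFG _ _ (Ioo_subset_Icc_self (hpI p hs))
  have hpE : ∀ p : ι₂, Disjoint (F p.1 '' p.2) E := by
    intro p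
    rw [disjoint_left]
    rintro _ ⟨s, hs, rfl⟩
    exact (hpU p hs).2
  have hpω : ∀ p : ι₂, Disjoint (F p.1 '' p.2) (omegaSet L) := fun p =>
    disjoint_left.2 fun x hx hxω => disjoint_left.1 (hpE p) hx (Or.inl ⟨hxω, hpG p hx⟩)
  have hclL : ∀ j x, x ∈ closure (range (L j)) → x ∈ range (L j) ∨ x ∈ omegaSet L := by
    intro j x hx
    rw [closure_range_eq (h.quasiArc j).continuous] at hx
    exact hx.imp_right fun hx => limitSet_subset_omegaSet j hx
  refine ⟨ι₁ ⊕ ι₂, inferInstance, g, ?_, ?_, ?_, ?_⟩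
  · rintro (j | p)
    · refine ⟨(h.isEmbedding j).comp hζ, ?_⟩
      rw [hr₁, ← isClosed_compl_iff]
      -- Closures of the other quasi-arcs add only points of `omegaSet L`, which `L j` avoids.
      have heq : (L j '' Ioi 0)ᶜ = G ∪ ⋃ l ∈ {l | l ≠ j.1}, closure (range (L l)) := by
        ext x
        constructor
        · intro hx
          have : x ∈ G ∪ ⋃ i, range (L i) := h.union_eq ▸ mem_univ x
          rcases this with hG | hL
          · exact Or.inl hG
          · obtain ⟨l, t, rfl⟩ := mem_iUnion.1 hL
            by_cases hlj : l = j.1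
            · rcases eq_or_ne t 0 with rfl | ht
              · exact Or.inl (hL0 l)
              · subst hlj
                exact (hx ⟨t, pos_iff_ne_zero.2 ht, rfl⟩).elim
            · exact Or.inr (mem_iUnion₂.2 ⟨l, hlj, subset_closure (mem_range_self t)⟩)
        · rintro (hx | hx) ⟨t, ht, rfl⟩
          · exact h.notMem_graph ht hx
          · obtain ⟨l, hlj, hl⟩ := mem_iUnion₂.1 hx
            rcases hclL l _ hl with hl | hl
            · exact disjoint_left.1 (h.disjoint _ _ hlj) hl (mem_range_self t)
            · exact disjoint_left.1 j.2 (mem_range_self t) hl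
      rw [heq]
      exact h.isClosed_graph.union ((toFinite _).isClosed_biUnion fun _ _ => isClosed_closure)
    · refine ⟨hF.isEmbedding_comp p.1 (hη _ _ p.2.2).isEmbedding ?_, ?_⟩
      · rw [hηr _ _ p.2.2]
        exact (hpI p).trans Ioo_subset_Icc_self
      · rw [hr₂, ← isClosed_compl_iff]
        have hop : IsOpen (p.2 : Set ℝ) := by
          rw [← hηr _ _ p.2.2]
          exact (hη _ _ p.2.2).isOpen_range
        have heq : (F p.1 '' p.2)ᶜ = (G \ F p.1 '' p.2) ∪ ⋃ l, closure (range (L l)) := by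
          ext x
          constructor
          · intro hx
            have : x ∈ G ∪ ⋃ i, range (L i) := h.union_eq ▸ mem_univ x
            rcases this with hG | hL
            · exact Or.inl ⟨hG, hx⟩
            · obtain ⟨l, hl⟩ := mem_iUnion.1 hL
              exact Or.inr (mem_iUnion.2 ⟨l, subset_closure hl⟩)
          · rintro (hx | hx) hxF
            · exact hx.2 hxF
            · obtain ⟨l, hl⟩ := mem_iUnion.1 hx
              rcases hclL l x hl with hl | hl
              · have h1 : x ∈ ({L l 0} : Set X) := h.inter_graph l ▸ ⟨hl, hpG p hxF⟩
                exact disjoint_left.1 (hpE p) hxF (Or.inr ⟨l, h1.symm⟩)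
              · exact disjoint_left.1 (hpω p) hxF hl
        rw [heq]
        exact (hF.isClosed_sdiff_image _ (hpI p) hop).union
          (isClosed_iUnion_of_finite fun _ => isClosed_closure)
  · have h12 : ∀ (j : ι₁) (p : ι₂), Disjoint (L j '' Ioi 0) (F p.1 '' p.2) := by
      intro j p
      rw [disjoint_left]
      rintro _ ⟨t, ht, rfl⟩ hx
      exact h.notMem_graph ht (hpG p hx)
    rintro (j | p) (l | q) hne
    · rw [hr₁, hr₁]
      have : (j : Fin n) ≠ l := fun h => hne (congrArg Sum.inl (Subtype.ext h))
      exact (h.disjoint _ _ this).mono (image_subset_range _ _) (image_subset_range _ _)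
    · rw [hr₁, hr₂]; exact h12 j q
    · rw [hr₁, hr₂]; exact (h12 l p).symm
    · rw [hr₂, hr₂, disjoint_left]
      rintro _ ⟨s, hs, rfl⟩ ⟨t, ht, hst⟩
      obtain ⟨i, C⟩ := p
      obtain ⟨j, C'⟩ := q
      by_cases hij : i = j
      · subst hij
        have hst := hF.injOn i (Ioo_subset_Icc_self (hpI ⟨i, C'⟩ ht))
          (Ioo_subset_Icc_self (hpI ⟨i, C⟩ hs)) hst
        subst hst
        have := eq_of_mem_componentsOf C.2 C'.2 hs ht
        rw [Subtype.ext this] at hne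
        exact hne rfl
      · exact hF.ne i j hij s (hpI ⟨i, C⟩ hs) t (Ioo_subset_Icc_self (hpI ⟨j, C'⟩ ht)) hst.symm
  · rintro (j | p)
    · rw [hr₁]
      exact j.2.mono_left (image_subset_range _ _)
    · rw [hr₂]; exact hpω p
  -- The exceptional points are endpoints of quasi-arcs and of edges.
  · have hfin : (A ∪ ⋃ i, {F i 0, F i 1}).Finite :=
      hA.union (finite_iUnion fun i => by simp)
    refine hfin.subset fun x hx => ?_
    rw [mem_compl_iff, mem_union, not_or, mem_iUnion, not_exists] at hx
    obtain ⟨hx, hxω⟩ := hx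
    by_cases hxA : x ∈ A
    · exact Or.inl hxA
    right
    have : x ∈ G ∪ ⋃ i, range (L i) := h.union_eq ▸ mem_univ x
    rcases this with hG | hL
    · have hxE : x ∉ E := fun h => h.elim (fun h => hxω h.1) hxA
      rw [← hF.iUnion_eq] at hG
      obtain ⟨i, s, hs, rfl⟩ := mem_iUnion.1 hG
      refine mem_iUnion.2 ⟨i, ?_⟩
      by_contra hne
      simp only [mem_insert_iff, mem_singleton_iff, not_or] at hne
      have hsU : s ∈ U i := by
        refine ⟨⟨lt_of_le_of_ne hs.1 ?_, lt_of_le_of_ne hs.2 ?_⟩, hxE⟩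
        · rintro rfl; exact hne.1 rfl
        · rintro rfl; exact hne.2 rfl
      have hc := mem_component hsU
      refine hx (Sum.inr ⟨i, _, hc.1⟩) ?_
      rw [hr₂]
      exact ⟨s, hc.2, rfl⟩
    · exfalso
      obtain ⟨l, t, rfl⟩ := mem_iUnion.1 hL
      have ht : 0 < t := pos_iff_ne_zero.2 fun h0 => hxA ⟨l, by rw [h0]⟩
      rcases h.range_subset_or_disjoint l with h1 | h1
      · exact hxω (h1 (mem_range_self t))
      · refine hx (Sum.inl ⟨l, h1⟩) ?_
        rw [hr₁]
        exact ⟨t, ht, rfl⟩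

/-! ### Small arcs -/

section Arcs

variable {Y : Type*} [TopologicalSpace Y] [T2Space Y]

theorem isArc_image_Icc {F : ℝ → Y} {a b : ℝ} (hab : a < b) (hc : ContinuousOn F (Icc a b))
    (hi : InjOn F (Icc a b)) : IsArc (F '' Icc a b) := by
  have h1 : IsEmbedding ((Icc a b).domRestrict F) :=
    (hc.domRestrict.isClosedEmbedding hi.injective).isEmbedding
  refine ⟨(Icc a b).domRestrict F ∘ (iccHomeoI a b hab).symm,
    h1.comp (iccHomeoI a b hab).symm.isEmbedding, ?_⟩
  rw [(iccHomeoI a b hab).symm.surjective.range_comp, range_domRestrict]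

/-- Every point of a topological graph lies on an arbitrarily small arc. -/
theorem IsTopologicalGraph.exists_isArc_subset (hY : IsTopologicalGraph Y) {O : Set Y}
    (hO : IsOpen O) {y : Y} (hy : y ∈ O) : ∃ A, IsArc A ∧ y ∈ A ∧ A ⊆ O := by
  obtain ⟨k, e, he, hun, -⟩ := hY.edges
  obtain ⟨i, s, rfl⟩ := mem_iUnion.1 (hun ▸ mem_univ y : y ∈ ⋃ i, range (e i))
  let F : ℝ → Y := fun t => e i (projIcc 0 1 zero_le_one t)
  have hF : Continuous F := (he i).continuous.comp continuous_projIcc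
  have hFs : F s = e i s := congrArg (e i) (projIcc_val zero_le_one s)
  have hFi : InjOn F (Icc 0 1) := fun a ha b hb hab => by
    have := (he i).injective hab
    rwa [projIcc_of_mem _ ha, projIcc_of_mem _ hb, Subtype.mk.injEq] at this
  obtain ⟨δ, hδ, hball⟩ := Metric.isOpen_iff.1 (hO.preimage hF) s (by rwa [mem_preimage, hFs])
  obtain ⟨hs0, hs1⟩ := s.2
  have hlt : max 0 ((s : ℝ) - δ / 2) < min 1 ((s : ℝ) + δ / 2) :=
    max_lt (lt_min one_pos (by linarith)) (lt_min (by linarith) (by linarith))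
  have hsub : Icc (max 0 ((s : ℝ) - δ / 2)) (min 1 ((s : ℝ) + δ / 2)) ⊆ Icc 0 1 :=
    Icc_subset_Icc (le_max_left _ _) (min_le_left _ _)
  refine ⟨_, isArc_image_Icc hlt hF.continuousOn (hFi.mono hsub), ⟨s, ⟨?_, ?_⟩, hFs⟩, ?_⟩
  · exact max_le hs0 (by linarith)
  · exact le_min hs1 (by linarith)
  · rintro _ ⟨t, ht, rfl⟩
    refine hball ?_
    rw [Metric.mem_ball, Real.dist_eq, abs_lt]
    have h1 := (le_max_right _ _).trans ht.1
    have h2 := ht.2.trans (min_le_right _ _)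
    constructor <;> linarith

theorem IsTopologicalGraph.nontrivial {Y : Type*} [TopologicalSpace Y]
    (hY : IsTopologicalGraph Y) : Nontrivial Y := by
  obtain ⟨k, e, he, hun, -⟩ := hY.edges
  have := hY.continuum.connected
  obtain ⟨y⟩ := (inferInstance : Nonempty Y)
  obtain ⟨i, -⟩ := mem_iUnion.1 (hun ▸ mem_univ y : y ∈ ⋃ i, range (e i))
  exact (he i).injective.nontrivial

end Arcs

/-! ### The collapsing map is an associated map -/

section Main

variable {X : Type u} [MetricSpace X] {G : Set X} {n : ℕ} {L : Fin n → ℝ≥0 → X}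

/-- The quotient map of a quasi-graph that collapses the components of its limit sets exhibits a
generalized sin(1/x)-type continuum. -/
theorem IsQuasiGraph.isSinTypeMap_mk_collapse (h : IsQuasiGraph G L)
    (hΛ : ∀ Λ ∈ componentsOf (omegaSet L),
      (∃ φ : ℝ≥0 → X, IsQuasiArc φ ∧ limitSet φ = Λ) ∧ ClassW Λ) :
    IsSinTypeMap (Quotient.mk (collapse (omegaSet L)) :
      X → Quotient (collapse (omegaSet L))) := by
  have := h.continuum.compact
  have := h.continuum.connected
  set W := omegaSet L with hW
  set q : X → Quotient (collapse W) := Quotient.mk (collapse W) with hq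
  have hcomp : ∀ Λ ∈ componentsOf W, ∃ i, limitSet (L i) = Λ ∧ Disjoint (range (L i)) W :=
    fun Λ hΛ' => h.exists_limitSet_eq_component hΛ' (hΛ Λ hΛ').1
  have hfin := h.finite_componentsOf
  have hcl : ∀ Λ ∈ componentsOf W, IsClosed Λ := fun Λ hΛ' => by
    obtain ⟨i, rfl, -⟩ := hcomp Λ hΛ'
    exact isClosed_limitSet
  have hqcl : IsClosedMap q := isClosedMap_mk_collapse hfin hcl
  have hqc : Continuous q := continuous_quotient_mk'
  have hqs : Function.Surjective q := Quotient.mk_surjective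
  have := t2Space_of_isClosedMap hqc hqcl hqs
  have := secondCountableTopology_of_isClosedMap hqc hqcl hqs
  have hY : IsContinuum (Quotient (collapse W)) := ⟨inferInstance, inferInstance, inferInstance⟩
  have : Nontrivial X := by
    have := h.graph.nontrivial
    exact (Subtype.val_injective (p := (· ∈ G))).nontrivial
  -- Every component is the limit set of a quasi-arc lying off `W`.
  have hdense : Dense Wᶜ := by
    intro x
    by_cases hx : x ∈ W
    · obtain ⟨hc, hxc⟩ := mem_component hx
      obtain ⟨i, hi, hd⟩ := hcomp _ hc
      rw [← hi] at hxc
      exact closure_mono hd.subset_compl_right (limitSet_subset_closure_range hxc)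
    · exact subset_closure hx
  have hmono : ∀ y, IsConnected (q ⁻¹' {y}) := by
    intro y
    obtain ⟨x, rfl⟩ := hqs y
    by_cases hx : x ∈ W
    · obtain ⟨hc, hxc⟩ := mem_component hx
      rw [hq, preimage_mk_collapse_of_mem hc hxc]
      exact isConnected_of_mem_componentsOf hc
    · rw [hq, preimage_mk_collapse_of_notMem hx]
      exact isConnected_singleton
  have hnd : ∀ y, IsNowhereDense (q ⁻¹' {y}) := by
    intro y
    have hycl : IsClosed (q ⁻¹' {y}) := isClosed_singleton.preimage hqc
    rw [hycl.isNowhereDense_iff]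
    obtain ⟨x, rfl⟩ := hqs y
    by_cases hx : x ∈ W
    · obtain ⟨hc, hxc⟩ := mem_component hx
      rw [hq, preimage_mk_collapse_of_mem hc hxc]
      exact subset_empty_iff.1 ((interior_mono (subset_of_mem_componentsOf hc)).trans
        (interior_eq_empty_iff_dense_compl.2 hdense).subset)
    · rw [hq, preimage_mk_collapse_of_notMem hx]
      exact interior_singleton x
  -- Otherwise all of `X` would be a single nowhere dense fibre.
  have : Nontrivial (Quotient (collapse W)) := by
    rw [← not_subsingleton_iff_nontrivial]
    intro hsub
    obtain ⟨x⟩ := (inferInstance : Nonempty X)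
    have huniv : q ⁻¹' {q x} = univ := eq_univ_of_forall fun z => Subsingleton.elim (q z) (q x)
    have := hnd (q x)
    rw [huniv, IsNowhereDense, closure_univ, interior_univ] at this
    exact univ_nonempty.ne_empty this
  have hgraph : IsTopologicalGraph (Quotient (collapse W)) := by
    obtain ⟨ι, _, g, hg, hgd, hgW, hgfin⟩ := h.exists_openArcs
    refine isTopologicalGraph_of_openArcs hY (g := fun a => q ∘ g a)
      (fun a => isOpenEmbedding_mk_collapse_comp (hg a) (hgW a)) (fun a b hab => ?_) ?_
    · rw [disjoint_left]
      rintro _ ⟨s, rfl⟩ ⟨t, ht⟩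
      have h1 : g b t ∈ q ⁻¹' {q (g a s)} := ht
      rw [hq, preimage_mk_collapse_of_notMem (disjoint_left.1 (hgW a) (mem_range_self s))] at h1
      exact disjoint_left.1 (hgd a b hab) (mem_range_self s) ⟨t, h1⟩
    · have hqW : (q '' W).Finite := by
        have : ∀ Λ : Set X, ∃ y, Λ ∈ componentsOf W → q '' Λ ⊆ {y} := by
          intro Λ
          by_cases hΛ' : Λ ∈ componentsOf W
          · obtain ⟨x, hx⟩ := (isConnected_of_mem_componentsOf hΛ').nonempty
            refine ⟨q x, fun _ => ?_⟩
            rw [image_subset_iff, hq, preimage_mk_collapse_of_mem hΛ' hx]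
          · exact ⟨q h.continuum.connected.toNonempty.some,
              fun h' => (hΛ' h').elim⟩
        choose y hy using this
        refine (hfin.image y).subset ?_
        rintro _ ⟨x, hx, rfl⟩
        obtain ⟨hc, hxc⟩ := mem_component hx
        exact ⟨_, hc, (hy _ hc (mem_image_of_mem q hxc)).symm⟩
      refine ((hgfin.image q).union hqW).subset fun z hz => ?_
      obtain ⟨x, rfl⟩ := hqs z
      by_cases hx : x ∈ W
      · exact Or.inr (mem_image_of_mem q hx)
      · refine Or.inl (mem_image_of_mem q fun hx' => hx'.elim (fun hx' => ?_) hx)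
        obtain ⟨a, s, rfl⟩ := mem_iUnion.1 hx'
        exact hz (mem_iUnion.2 ⟨a, s, rfl⟩)
  refine ⟨hgraph, hqc, hmono, hnd, hdense.mono fun x hx => ⟨x, preimage_mk_collapse_of_notMem hx⟩,
    ?_⟩
  intro y K hK hKy ε hε
  obtain ⟨x, rfl⟩ := hqs y
  by_cases hx : x ∈ W
  · obtain ⟨hc, hxc⟩ := mem_component hx
    rw [hq, preimage_mk_collapse_of_mem hc hxc] at hKy
    obtain ⟨i, hi, hd⟩ := hcomp _ hc
    have hcW := (hΛ _ hc).2
    rw [← hi] at hKy hcW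
    obtain ⟨a, b, hab, hdist⟩ := exists_hausdorffDist_image_Icc_lt (h.quasiArc i).continuous hcW hK
      hKy hε
    -- Off `W` the map `q` is injective and sets are saturated, so the image is an arc whose
    -- preimage is exactly the approximating arc.
    refine ⟨q '' (L i '' Icc a b), ?_, ?_⟩
    · have heq : q '' (L i '' Icc a b) = (fun s : ℝ => q (L i s.toNNReal)) '' Icc (a : ℝ) b := by
        have hI : Icc a b = Real.toNNReal '' Icc (a : ℝ) b := by
          ext t
          constructor
          · exact fun ht => ⟨t, ⟨NNReal.coe_le_coe.2 ht.1, NNReal.coe_le_coe.2 ht.2⟩,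
              Real.toNNReal_coe⟩
          · rintro ⟨s, hs, rfl⟩
            exact ⟨NNReal.le_toNNReal_of_coe_le hs.1, Real.toNNReal_le_iff_le_coe.2 hs.2⟩
        rw [hI, image_image, image_image]
      rw [heq]
      refine isArc_image_Icc (NNReal.coe_lt_coe.2 hab) ?_ ?_
      · exact (hqc.comp ((h.quasiArc i).continuous.comp continuous_real_toNNReal)).continuousOn
      · intro s hs t ht hst
        have h1 : L i t.toNNReal ∈ q ⁻¹' {q (L i s.toNNReal)} := hst.symm
        rw [hq, preimage_mk_collapse_of_notMem (disjoint_left.1 hd (mem_range_self _))] at h1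
        have h2 := (h.quasiArc i).injective h1
        have h3 := a.coe_nonneg
        exact ((Real.toNNReal_eq_toNNReal_iff (h3.trans ht.1) (h3.trans hs.1)).1 h2).symm
    · rwa [hq, preimage_image_mk_collapse (hd.mono_left (image_subset_range _ _))]
  · rw [hq, preimage_mk_collapse_of_notMem hx] at hKy
    have hKx : K = {x} := hK.2.nonempty.subset_singleton_iff.1 hKy
    -- Over a one-point fibre, any small enough arc through `q x` works, because `q` is closed.
    obtain ⟨O, hO, hxO, hOsub⟩ := exists_isOpen_preimage_subset hqcl (y := q x)
      (U := Metric.ball x (ε / 2)) Metric.isOpen_ball (by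
        rw [hq, preimage_mk_collapse_of_notMem hx, singleton_subset_iff]
        exact Metric.mem_ball_self (by positivity))
    obtain ⟨A, hA, hxA, hAO⟩ := hgraph.exists_isArc_subset hO hxO
    refine ⟨A, hA, (Metric.hausdorffDist_le_of_mem_dist (r := ε / 2) (by positivity) ?_ ?_).trans_lt
      (by linarith)⟩
    · rw [hKx]
      rintro z hz
      rw [mem_singleton_iff.1 hz]
      exact ⟨x, hxA, by rw [dist_self]; positivity⟩
    · intro z hz
      exact ⟨x, by rw [hKx]; rfl, (hOsub (hAO hz)).le⟩

end Main

end Tranched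

theorem mainTheorem2 {X : Type u} [MetricSpace X] (G : Set X) (n : ℕ) (L : Fin n → ℝ≥0 → X)
    (hX : Tranched.IsQuasiGraph G L)
    (hΛ : ∀ Λ ∈ Tranched.componentsOf (Tranched.omegaSet L),
      (∃ φ : ℝ≥0 → X, Tranched.IsQuasiArc φ ∧ Tranched.limitSet φ = Λ) ∧ Tranched.ClassW Λ) :
    Tranched.IsGeneralizedSinContinuum X ∧
      Tranched.IsSinTypeMap
        (Quotient.mk (Tranched.collapse (Tranched.omegaSet L)) :
          X → Quotient (Tranched.collapse (Tranched.omegaSet L))) := by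
  have h := hX.isSinTypeMap_mk_collapse hΛ
  exact ⟨⟨hX.continuum, _, inferInstance, _, h⟩, h⟩
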